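/- Let $(M,g)$ be a time-oriented spacetime: a smooth four-manifold with a smooth metric $g$ of signature $(-,+,+,+)$ admitting a smooth everywhere time-like vector field (units: $c=1$, Einstein equations $R-\tfrac12 (\operatorname{tr}R)\,g=T$, where $R$ is the Ricci tensor). For 2-tensors $S$, traces and powers are taken with respect to $g$, $(S^2)_{\alpha\beta}=S_\alpha{}^\lambda S_{\lambda\beta}$, and $S({\rm d}f)$ denotes the covector $S_{\alpha\beta}g^{\beta\gamma}\partial_\gamma f$. Put $$t=\operatorname{tr}R,\quad N=R-\tfrac14 t\,g,\quad q=-2\sqrt[3]{\tfrac13\operatorname{tr}N^3},\quad Q=N-\tfrac14 q\,g,\quad \rho=\tfrac14(3q+t),\quad p=\tfrac14(q-t).$$ **Theorem.** The metric $g$ is an isoenergetic perfect fluid solution modeling an ideal gas in local thermal equilibrium that fulfills the compressibility conditions $\mathrm H_1$ and $\mathrm H_2$ if, and only if, the Ricci tensor satisfies everywhere $$Q^2+q\,Q=0,\qquad Q(x,x)>0\ \text{ for every time-like vector } x,\qquad -q<t\le q,$$ and $$Q({\rm d}\rho)=0,\qquad Q({\rm d}p)=0 .$$ Here the first property means the following.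 There are a smooth future-pointing unit time-like field $u$ and smooth functions $\rho,p$ such that the Einstein equations hold with $T=(\rho+p)\,u\otimes u+p\,g$, the energy conditions of a gas $0\le p<\rho$ hold, and $u(\rho)=0$ (isoenergetic evolution). Moreover $u,\rho,p$ are the evolution in local thermal equilibrium of an ideal gas, that is, there are smooth functions of state $r>0$ (matter density), $\epsilon$ (specific internal energy), $\Theta$ (temperature) of the specific entropy $s$ and the pressure $p$, on an open set of states $(s,p)$, with $$\Theta\,{\rm d}s={\rm d}\epsilon+p\,{\rm d}(1/r),\qquad p=k\,r\,\Theta\ \text{ for some constant } k>0,$$ whose dynamic volume $\tau=(1+\epsilon+p/r)/r$ satisfies $$\mathrm H_1:\ (\tau'_p)_s<0,\ (\tau''_p)_s>0,\qquad \mathrm H_2:\ (\tau'_s)_p>0 ,$$ and there is a smooth entropy field $s$ on $M$, whose states $(s,p)$ belong to that set, such that $\rho=r(1+\epsilon)$, the evolution is adiabatic, $u(s)=0$, and matter is conserved, $u(r)+r\,\nabla_\alpha u^\alpha=0$. -/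

import Mathlib

open scoped Manifold ContDiff

noncomputable section

set_option maxSynthPendingDepth 3

namespace IdealGas

/-- The model space `ℝ⁴` of a spacetime. -/
abbrev E4 : Type := EuclideanSpace ℝ (Fin 4)

/-! ### Levi-Civita connection and Ricci tensor on a coordinate domain

`G` is the coordinate expression of a metric: `G y v w` is the product at the point `y` of the
vectors with components `v` and `w`. -/

/-- Exchange of the two arguments of a bilinear form, as a continuous linear map. -/
def flipForm : (E4 →L[ℝ] E4 →L[ℝ] ℝ) →L[ℝ] (E4 →L[ℝ] E4 →L[ℝ] ℝ) :=
  ((ContinuousLinearMap.flipₗᵢ ℝ E4 E4 ℝ).toContinuousLinearEquiv :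
    (E4 →L[ℝ] E4 →L[ℝ] ℝ) ≃L[ℝ] (E4 →L[ℝ] E4 →L[ℝ] ℝ))

theorem flipForm_apply (B : E4 →L[ℝ] E4 →L[ℝ] ℝ) (v w : E4) : flipForm B v w = B w v := rfl

/-- Christoffel symbols of the first kind:
`Γ₁(v, w)(z) = ½ (∂_v G(w, z) + ∂_w G(v, z) - ∂_z G(v, w))`. -/
def christoffelFirst (G : E4 → E4 →L[ℝ] E4 →L[ℝ] ℝ) (y : E4) :
    E4 →L[ℝ] E4 →L[ℝ] E4 →L[ℝ] ℝ :=
  (1 / 2 : ℝ) • (fderiv ℝ G y + (fderiv ℝ G y).flip - flipForm.comp (fderiv ℝ G y).flip)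

theorem christoffelFirst_apply (G : E4 → E4 →L[ℝ] E4 →L[ℝ] ℝ) (y v w z : E4) :
    christoffelFirst G y v w z =
      1 / 2 * (fderiv ℝ G y v w z + fderiv ℝ G y w v z - fderiv ℝ G y z v w) := by
  simp [christoffelFirst, flipForm_apply]

/-- Christoffel symbols of the second kind: the index `z` of `christoffelFirst` is raised with
the inverse of `G y`, seen as the map from vectors to covectors. -/
def christoffel (G : E4 → E4 →L[ℝ] E4 →L[ℝ] ℝ) (y : E4) : E4 →L[ℝ] E4 →L[ℝ] E4 :=
  (ContinuousLinearMap.compL ℝ E4 (E4 →L[ℝ] ℝ) E4 (G y).inverse).comp (christoffelFirst G y)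

theorem christoffel_apply (G : E4 → E4 →L[ℝ] E4 →L[ℝ] ℝ) (y v w : E4) :
    christoffel G y v w = (G y).inverse (christoffelFirst G y v w) := rfl

/-- The curvature `R(v, w) z = ∂_v Γ(w, z) - ∂_w Γ(v, z) + Γ(v, Γ(w, z)) - Γ(w, Γ(v, z))`. -/
def riemannCoord (G : E4 → E4 →L[ℝ] E4 →L[ℝ] ℝ) (y v w z : E4) : E4 :=
  fderiv ℝ (christoffel G) y v w z - fderiv ℝ (christoffel G) y w v z
    + christoffel G y v (christoffel G y w z) - christoffel G y w (christoffel G y v z)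

/-- The Ricci tensor `Ric(w, z) = tr (v ↦ R(v, w) z)`. -/
def ricciCoord (G : E4 → E4 →L[ℝ] E4 →L[ℝ] ℝ) (y : E4) : E4 →L[ℝ] E4 →L[ℝ] ℝ :=
  LinearMap.toContinuousBilinearMap
    (LinearMap.mk₂ ℝ
      (fun w z => ∑ i : Fin 4, (riemannCoord G y (EuclideanSpace.single i 1) w z) i)
      (by
        intro a b c
        rw [← Finset.sum_add_distrib]
        exact Finset.sum_congr rfl fun i _ => by simp [riemannCoord]; ring)
      (by
        intro k a c
        rw [smul_eq_mul, Finset.mul_sum]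
        exact Finset.sum_congr rfl fun i _ => by simp [riemannCoord]; ring)
      (by
        intro a b c
        rw [← Finset.sum_add_distrib]
        exact Finset.sum_congr rfl fun i _ => by simp [riemannCoord]; ring)
      (by
        intro k a c
        rw [smul_eq_mul, Finset.mul_sum]
        exact Finset.sum_congr rfl fun i _ => by simp [riemannCoord]; ring))

theorem ricciCoord_apply (G : E4 → E4 →L[ℝ] E4 →L[ℝ] ℝ) (y w z : E4) :
    ricciCoord G y w z =
      ∑ i : Fin 4, (riemannCoord G y (EuclideanSpace.single i 1) w z) i := rfl

/-- The covariant derivative `v ↦ ∇_v U = ∂_v U + Γ(v, U)` of a vector field. -/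
def covDerivCoord (G : E4 → E4 →L[ℝ] E4 →L[ℝ] ℝ) (U : E4 → E4) (y : E4) : E4 →L[ℝ] E4 :=
  fderiv ℝ U y + (christoffel G y).flip (U y)

/-! ### Lorentzian four-manifolds -/

/-- A smooth metric of signature `(-,+,+,+)` on the four-manifold `M`. -/
structure LorentzMetric (M : Type*) [TopologicalSpace M] [ChartedSpace E4 M]
    [IsManifold (𝓡 4) ∞ M] where
  /-- The product of two vectors at a point. -/
  val : ∀ x : M, TangentSpace (𝓡 4) x →L[ℝ] TangentSpace (𝓡 4) x →L[ℝ] ℝ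
  symm : ∀ (x : M) (v w : TangentSpace (𝓡 4) x), val x v w = val x w v
  signature : ∀ x : M, ∃ b : Module.Basis (Fin 4) ℝ (TangentSpace (𝓡 4) x),
    ∀ i j, val x (b i) (b j) = if i = j then (if i = 0 then -1 else 1) else 0
  smooth : ContMDiff (𝓡 4) ((𝓡 4).prod 𝓘(ℝ, E4 →L[ℝ] E4 →L[ℝ] ℝ)) ∞
    (fun x => Bundle.TotalSpace.mk' (E4 →L[ℝ] E4 →L[ℝ] ℝ)
      (E := fun x : M => TangentSpace (𝓡 4) x →L[ℝ] TangentSpace (𝓡 4) x →L[ℝ] ℝ) x (val x))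

/-- Smoothness of a vector field. -/
def SmoothVectorField {M : Type*} [TopologicalSpace M] [ChartedSpace E4 M]
    [IsManifold (𝓡 4) ∞ M] (u : ∀ x : M, TangentSpace (𝓡 4) x) : Prop :=
  ContMDiff (𝓡 4) (𝓡 4).tangent ∞ (fun x => (⟨x, u x⟩ : TangentBundle (𝓡 4) M))

/-- The real cube root, for arguments of either sign. -/
def cbrt (a : ℝ) : ℝ := if 0 ≤ a then a ^ (1 / 3 : ℝ) else -((-a) ^ (1 / 3 : ℝ))

namespace LorentzMetric

variable {M : Type*} [TopologicalSpace M] [ChartedSpace E4 M] [IsManifold (𝓡 4) ∞ M]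
  (g : LorentzMetric M)

/-- The coordinate expression of the metric in the chart around `c`. -/
def inChart (c : M) (y : E4) : E4 →L[ℝ] E4 →L[ℝ] ℝ :=
  let x : M := (extChartAt (𝓡 4) c).symm y
  let A : E4 →L[ℝ] E4 := mfderiv 𝓘(ℝ, E4) (𝓡 4) (extChartAt (𝓡 4) c).symm y
  let B : E4 →L[ℝ] E4 →L[ℝ] ℝ := g.val x
  B.bilinearComp A A

theorem inChart_apply (c : M) (y v w : E4) :
    g.inChart c y v w = g.val ((extChartAt (𝓡 4) c).symm y)
      (mfderiv 𝓘(ℝ, E4) (𝓡 4) (extChartAt (𝓡 4) c).symm y v)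
      (mfderiv 𝓘(ℝ, E4) (𝓡 4) (extChartAt (𝓡 4) c).symm y w) := rfl

/-- The Ricci tensor at `x`, computed in the chart around `x` (Mathlib identifies the tangent
space at `x` with `ℝ⁴` through this chart). -/
def ricci (x : M) : TangentSpace (𝓡 4) x →L[ℝ] TangentSpace (𝓡 4) x →L[ℝ] ℝ :=
  ricciCoord (g.inChart x) (extChartAt (𝓡 4) x x)

/-- The expansion `θ = ∇_α u^α` at `x`, computed in the chart around `x`. -/
def expansion (u : ∀ x : M, TangentSpace (𝓡 4) x) (x : M) : ℝ :=
  let U : E4 → E4 := fun y =>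
    mfderiv (𝓡 4) 𝓘(ℝ, E4) (extChartAt (𝓡 4) x) ((extChartAt (𝓡 4) x).symm y)
      (u ((extChartAt (𝓡 4) x).symm y))
  LinearMap.trace ℝ E4 (covDerivCoord (g.inChart x) U (extChartAt (𝓡 4) x x)).toLinearMap

/-- The vector associated with a covector. -/
def sharp (x : M) (ℓ : TangentSpace (𝓡 4) x →L[ℝ] ℝ) : TangentSpace (𝓡 4) x :=
  (g.val x).inverse ℓ

/-- The endomorphism `S^α_β` associated with a 2-tensor `S_αβ`. -/
def mixed (x : M) (S : TangentSpace (𝓡 4) x →L[ℝ] TangentSpace (𝓡 4) x →L[ℝ] ℝ) :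
    TangentSpace (𝓡 4) x →L[ℝ] TangentSpace (𝓡 4) x :=
  (g.val x).inverse.comp S

/-- The square of a 2-tensor: `(S²)_αβ = S_α^λ S_λβ`. -/
def sqTensor (x : M) (S : TangentSpace (𝓡 4) x →L[ℝ] TangentSpace (𝓡 4) x →L[ℝ] ℝ) :
    TangentSpace (𝓡 4) x →L[ℝ] TangentSpace (𝓡 4) x →L[ℝ] ℝ :=
  S.comp (g.mixed x S)

/-- `t = tr R`. -/
def t (x : M) : ℝ := LinearMap.trace ℝ (TangentSpace (𝓡 4) x) (g.mixed x (g.ricci x)).toLinearMap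

/-- `N = R - ¼ t g`. -/
def N (x : M) : TangentSpace (𝓡 4) x →L[ℝ] TangentSpace (𝓡 4) x →L[ℝ] ℝ :=
  g.ricci x - (1 / 4 * g.t x) • g.val x

/-- `q = -2 (tr N³ / 3)^{1/3}`. -/
def q (x : M) : ℝ :=
  -2 * cbrt (LinearMap.trace ℝ (TangentSpace (𝓡 4) x) ((g.mixed x (g.N x)).toLinearMap ^ 3) / 3)

/-- `Q = N - ¼ q g`. -/
def Q (x : M) : TangentSpace (𝓡 4) x →L[ℝ] TangentSpace (𝓡 4) x →L[ℝ] ℝ :=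
  g.N x - (1 / 4 * g.q x) • g.val x

/-- `ρ = ¼ (3 q + t)`, as a concomitant of the Ricci tensor. -/
def rho (x : M) : ℝ := 1 / 4 * (3 * g.q x + g.t x)

/-- `p = ¼ (q - t)`, as a concomitant of the Ricci tensor. -/
def pres (x : M) : ℝ := 1 / 4 * (g.q x - g.t x)

/-- The algebraic conditions and inequalities on the Ricci tensor:
`Q² + q Q = 0`, `Q(v, v) > 0` for every time-like `v`, and `-q < t ≤ q`. -/
def RicciAlgebraic : Prop :=
  ∀ x : M, g.sqTensor x (g.Q x) + g.q x • g.Q x = 0 ∧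
    (∀ v : TangentSpace (𝓡 4) x, g.val x v v < 0 → 0 < g.Q x v v) ∧
    -g.q x < g.t x ∧ g.t x ≤ g.q x

/-- `Q(df) = 0`: the covector `Q_αβ ∂^β f` vanishes identically. -/
def QAnnihilates (f : M → ℝ) : Prop :=
  ∀ x : M, g.Q x (g.sharp x (mvfderiv (𝓡 4) f x)) = 0

/-- `X` is a time orientation: a smooth, everywhere time-like vector field. -/
def IsTimeOrientation (X : ∀ x : M, TangentSpace (𝓡 4) x) : Prop :=
  SmoothVectorField X ∧ ∀ x, g.val x (X x) (X x) < 0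

/-- `g` is a perfect fluid solution with unit velocity `u` (future pointing with respect to the
time orientation `X`), energy density `ρ` and pressure `p`: the Einstein equations
`R - ½ (tr R) g = (ρ + p) u ⊗ u + p g` hold. -/
structure IsPerfectFluidSolution (X u : ∀ x : M, TangentSpace (𝓡 4) x) (ρ p : M → ℝ) :
    Prop where
  smooth_u : SmoothVectorField u
  smooth_ρ : ContMDiff (𝓡 4) 𝓘(ℝ, ℝ) ∞ ρ
  smooth_p : ContMDiff (𝓡 4) 𝓘(ℝ, ℝ) ∞ p
  unit : ∀ x, g.val x (u x) (u x) = -1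
  future : ∀ x, g.val x (u x) (X x) < 0
  einstein : ∀ (x : M) (v w : TangentSpace (𝓡 4) x),
    g.ricci x v w - 1 / 2 * g.t x * g.val x v w =
      (ρ x + p x) * (g.val x (u x) v * g.val x (u x) w) + p x * g.val x v w

end LorentzMetric

/-! ### Thermodynamics -/

/-- The equations of state of a fluid in local thermal equilibrium. A pair `z = (s, p)` consists
of the specific entropy and the pressure; `r`, `ε`, `Θ` are the matter density, the specific
internal energy and the temperature as functions of state on the open set `D` of states. -/
structure Thermodynamics where
  /-- The set of states. -/
  D : Set (ℝ × ℝ)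
  /-- Matter density. -/
  r : ℝ × ℝ → ℝ
  /-- Specific internal energy. -/
  ε : ℝ × ℝ → ℝ
  /-- Temperature. -/
  Θ : ℝ × ℝ → ℝ
  isOpen_D : IsOpen D
  smooth_r : ContDiffOn ℝ ∞ r D
  smooth_ε : ContDiffOn ℝ ∞ ε D
  smooth_Θ : ContDiffOn ℝ ∞ Θ D
  r_pos : ∀ z ∈ D, 0 < r z
  /-- The energy balance `Θ ds = dε + p dv`, with `v = 1 / r`. -/
  balance : ∀ z ∈ D, Θ z • ContinuousLinearMap.fst ℝ ℝ ℝ =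
    fderiv ℝ ε z + z.2 • fderiv ℝ (fun z' => 1 / r z') z

namespace Thermodynamics

variable (T : Thermodynamics)

/-- The energy density `ρ = r (1 + ε)`. -/
def ρ (z : ℝ × ℝ) : ℝ := T.r z * (1 + T.ε z)

/-- The specific volume `v = 1 / r`. -/
def v (z : ℝ × ℝ) : ℝ := 1 / T.r z

/-- The dynamic volume `τ = (1 + i) v`, where `i = ε + p v` is the specific enthalpy. -/
def τ (z : ℝ × ℝ) : ℝ := (1 + (T.ε z + z.2 * T.v z)) * T.v z

/-- The compressibility conditions `(τ'_p)_s < 0` and `(τ''_p)_s > 0`. -/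
def H₁ : Prop := ∀ s p : ℝ, (s, p) ∈ T.D →
  deriv (fun p' => T.τ (s, p')) p < 0 ∧ 0 < iteratedDeriv 2 (fun p' => T.τ (s, p')) p

/-- The compressibility condition `(τ'_s)_p > 0`. -/
def H₂ : Prop := ∀ s p : ℝ, (s, p) ∈ T.D → 0 < deriv (fun s' => T.τ (s', p)) s

/-- The equation of state `p = k r Θ` of a generic ideal gas. -/
def IsIdealGas : Prop := ∃ k : ℝ, 0 < k ∧ ∀ z ∈ T.D, z.2 = k * T.r z * T.Θ z

end Thermodynamics

variable {M : Type*} [TopologicalSpace M] [ChartedSpace E4 M] [IsManifold (𝓡 4) ∞ M]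

/-- The hydrodynamic quantities `u`, `ρ`, `p` are an evolution in local thermal equilibrium of
the fluid with thermodynamics `T`: there is a specific entropy field `s` such that the states
`(s, p)` belong to the fluid, the energy density has the value given by the equations of state,
the evolution is adiabatic, `u(s) = 0`, and matter is conserved, `u(r) + r θ = 0`. -/
def IsEvolutionOf (g : LorentzMetric M) (u : ∀ x : M, TangentSpace (𝓡 4) x) (ρ p : M → ℝ)
    (T : Thermodynamics) : Prop :=
  ∃ s : M → ℝ, ContMDiff (𝓡 4) 𝓘(ℝ, ℝ) ∞ s ∧ ∀ x : M,
    (s x, p x) ∈ T.D ∧ ρ x = T.ρ (s x, p x) ∧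
    mvfderiv (𝓡 4) s x (u x) = 0 ∧
    mvfderiv (𝓡 4) (fun x' => T.r (s x', p x')) x (u x)
      + T.r (s x, p x) * g.expansion u x = 0

/-- `g` is an isoenergetic perfect fluid solution, with the energy conditions `0 ≤ p < ρ` of a
gas, that models an ideal gas in local thermal equilibrium satisfying `H₁` and `H₂`. -/
def IsIsoenergeticIdealGasSolution (g : LorentzMetric M)
    (X : ∀ x : M, TangentSpace (𝓡 4) x) : Prop :=
  ∃ (u : ∀ x : M, TangentSpace (𝓡 4) x) (ρ p : M → ℝ),
    g.IsPerfectFluidSolution X u ρ p ∧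
    (∀ x, 0 ≤ p x ∧ p x < ρ x) ∧
    (∀ x, mvfderiv (𝓡 4) ρ x (u x) = 0) ∧
    ∃ T : Thermodynamics, T.IsIdealGas ∧ T.H₁ ∧ T.H₂ ∧ IsEvolutionOf g u ρ p T

end IdealGas

end

open scoped Topology

noncomputable section

set_option maxSynthPendingDepth 3
set_option linter.unusedSectionVars false

namespace IdealGas

/-! For a perfect fluid, `R = (ρ+p) u⊗u + ½(ρ-p) g`, so `N = (ρ+p)(u⊗u + ¼g)` and `tr N³ =
-⅜(ρ+p)³`. Hence `q = ρ+p`, `Q = q u⊗u` and `t = ρ-3p`: the algebraic conditions and the formulas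
for `ρ` and `p` follow, and `Q(df) = 0` says that `f` is constant along `u`. Conversely `N` is
trace-free, so `tr Q = -q`; then `Q² + qQ = 0` makes `-Q/q` a projector of trace one, `Q` has rank
one, and its sign on time-like vectors produces the unit time-like `u` (`rank_one`,
`isPerfectFluidSolution`). Smoothness of `q` holds because `q > 0` keeps the cube root away from
zero.

In the direct implication the pressure has to be constant along `u`. The energy balance gives `r²
τ'_p = 1 - ρ'_p`, so `H₁` forces `ρ'_p > 1` (`one_lt_fderiv_ρ`); since `u(ρ) = u(s) = 0`, also `ρ'_p
u(p) = 0`.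

In the converse `u(ρ) = u(p) = 0`, and the contracted Bianchi identity along `u` reduces to `(ρ+p) θ
= 0` (`trace_covDerivCoord_eq_zero`). It is proved in coordinates whose Christoffel symbols vanish
at the point, which requires the covariance of curvature and divergence. Every function of `(ρ, p)`
is then constant along `u` and matter is conserved, so a single ideal gas realizing all pairs with
`0 ≤ p < ρ` suffices.

Such a gas is explicit. With `k = 1` the balance reads `dh = v (p ds + dp)`, `h = 1 + i`, so `h =
H(x)` with `x = p e^s`, and `v = e^s H'(x)`. In the parameter `a = √(1+4x)` the choice `H = ½(a+1)
exp(-(a-1)/(2(a+1)))` gives `τ = ½ exp(s - (a-1)/(a+1))` and `ρ + p = ½ e^{-s}(a+1)²`, which can be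
solved for `s` in closed form. -/

theorem two_le_infty : (2 : WithTop ℕ∞) ≤ ∞ := WithTop.coe_le_coe.2 (le_top : (2 : ℕ∞) ≤ ⊤)

theorem isInvertible_of_injective {V W : Type*} [AddCommGroup V] [Module ℝ V]
    [TopologicalSpace V] [IsTopologicalAddGroup V] [ContinuousSMul ℝ V] [T2Space V]
    [FiniteDimensional ℝ V] [AddCommGroup W] [Module ℝ W]
    [TopologicalSpace W] [IsTopologicalAddGroup W] [ContinuousSMul ℝ W] [T2Space W]
    [FiniteDimensional ℝ W] (h : Module.finrank ℝ V = Module.finrank ℝ W) {f : V →L[ℝ] W}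
    (hf : Function.Injective f) : f.IsInvertible :=
  ⟨(f.toLinearMap.linearEquivOfInjective hf h).toContinuousLinearEquiv, by ext; rfl⟩

theorem finrank_dual_E4 : Module.finrank ℝ E4 = Module.finrank ℝ (E4 →L[ℝ] ℝ) := by
  rw [← (LinearMap.toContinuousLinearMap (𝕜 := ℝ) (E := E4) (F' := ℝ)).finrank_eq]
  exact (Subspace.dual_finrank_eq (K := ℝ) (V := E4)).symm

/-! ### The Levi-Civita connection in coordinates. -/

/-- Smooth nondegenerate symmetric coordinate forms on an open subset of `ℝ⁴`. -/
structure IsMetricOn (G : E4 → E4 →L[ℝ] E4 →L[ℝ] ℝ) (s : Set E4) : Prop where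
  isOpen : IsOpen s
  contDiffOn : ContDiffOn ℝ ∞ G s
  symm : ∀ y ∈ s, ∀ v w, G y v w = G y w v
  inv : ∀ y ∈ s, (G y).IsInvertible

theorem fderiv_apply₂ {G : E4 → E4 →L[ℝ] E4 →L[ℝ] ℝ} {y : E4} (h : DifferentiableAt ℝ G y)
    (a v w : E4) : fderiv ℝ (fun z => G z v w) y a = fderiv ℝ G y a v w := by
  have h1 : HasFDerivAt (fun z => G z v w) _ y :=
    ((h.hasFDerivAt.clm_apply (hasFDerivAt_const v y)).clm_apply (hasFDerivAt_const w y))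
  rw [h1.fderiv]; simp

namespace IsMetricOn

variable {G : E4 → E4 →L[ℝ] E4 →L[ℝ] ℝ} {s : Set E4} (hG : IsMetricOn G s)
include hG

theorem contDiffAt {y : E4} (hy : y ∈ s) : ContDiffAt ℝ ∞ G y :=
  hG.contDiffOn.contDiffAt (hG.isOpen.mem_nhds hy)

theorem differentiableAt {y : E4} (hy : y ∈ s) : DifferentiableAt ℝ G y :=
  (hG.contDiffAt hy).differentiableAt (by simp)

theorem eventually_mem {y : E4} (hy : y ∈ s) : ∀ᶠ z in 𝓝 y, z ∈ s := hG.isOpen.mem_nhds hy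

theorem apply_inverse {y : E4} (hy : y ∈ s) (ℓ : E4 →L[ℝ] ℝ) : G y ((G y).inverse ℓ) = ℓ :=
  (hG.inv y hy).self_apply_inverse ℓ

theorem ext_apply {y : E4} (hy : y ∈ s) {v w : E4} (h : ∀ z, G y v z = G y w z) : v = w := by
  have : G y v = G y w := ContinuousLinearMap.ext h
  exact (hG.inv y hy).injective this

theorem fderiv_symm {y : E4} (hy : y ∈ s) (a v w : E4) :
    fderiv ℝ G y a v w = fderiv ℝ G y a w v := by
  rw [← fderiv_apply₂ (hG.differentiableAt hy), ← fderiv_apply₂ (hG.differentiableAt hy)]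
  have : (fun z => G z v w) =ᶠ[𝓝 y] fun z => G z w v := by
    filter_upwards [hG.eventually_mem hy] with z hz using hG.symm z hz v w
  rw [this.fderiv_eq]

theorem apply_christoffel {y : E4} (hy : y ∈ s) (v w z : E4) :
    G y (christoffel G y v w) z =
      1 / 2 * (fderiv ℝ G y v w z + fderiv ℝ G y w v z - fderiv ℝ G y z v w) := by
  rw [christoffel_apply, hG.apply_inverse hy, christoffelFirst_apply]

theorem christoffel_symm {y : E4} (hy : y ∈ s) (v w : E4) :
    christoffel G y v w = christoffel G y w v := by
  apply hG.ext_apply hy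
  intro z
  rw [hG.apply_christoffel hy, hG.apply_christoffel hy, hG.fderiv_symm hy z v w]
  ring

/-- Metricity of the connection. With the symmetry of `christoffel` it characterizes the connection,
and its derivative gives the skewness of the curvature. -/
theorem fderiv_eq {y : E4} (hy : y ∈ s) (a v w : E4) :
    fderiv ℝ G y a v w = G y (christoffel G y a v) w + G y v (christoffel G y a w) := by
  rw [hG.symm y hy v, hG.apply_christoffel hy, hG.apply_christoffel hy, hG.fderiv_symm hy w a v,
    hG.fderiv_symm hy a w v, hG.fderiv_symm hy v a w]
  ring

/-- Uniqueness of the Levi-Civita connection. -/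
theorem eq_christoffel {y : E4} (hy : y ∈ s) {C : E4 → E4 → E4} (hC : ∀ v w, C v w = C w v)
    (h : ∀ a v w, fderiv ℝ G y a v w = G y (C a v) w + G y v (C a w)) (v w : E4) :
    C v w = christoffel G y v w := by
  apply hG.ext_apply hy
  intro z
  rw [hG.apply_christoffel hy, h, h, h, hC w v, hC z v, hC z w, hG.symm y hy w, hG.symm y hy v]
  ring

theorem contDiffAt_inverse {y : E4} (hy : y ∈ s) :
    ContDiffAt ℝ ∞ (fun z => (G z).inverse) y :=
  ((hG.inv y hy).contDiffAt_map_inverse).comp y (hG.contDiffAt hy)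

theorem contDiffAt_christoffel {y : E4} (hy : y ∈ s) : ContDiffAt ℝ ∞ (christoffel G) y := by
  have h1 : ContDiffAt ℝ ∞ (fderiv ℝ G) y := (hG.contDiffAt hy).fderiv_right (by simp)
  have h2 : ContDiffAt ℝ ∞ (fun z => (fderiv ℝ G z).flip) y :=
    ((ContinuousLinearMap.flipₗᵢ ℝ E4 E4 (E4 →L[ℝ] ℝ)).contDiff.contDiffAt).comp y h1
  have h3 : ContDiffAt ℝ ∞ (christoffelFirst G) y := by
    unfold christoffelFirst
    exact ((h1.add h2).sub (contDiffAt_const.clm_comp h2)).const_smul (1 / 2 : ℝ)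
  unfold christoffel
  exact (((ContinuousLinearMap.compL ℝ E4 (E4 →L[ℝ] ℝ) E4).contDiff.contDiffAt).comp y
    (hG.contDiffAt_inverse hy)).clm_comp h3

theorem contDiffAt_riemannCoord {y : E4} (hy : y ∈ s) (v w z : E4) :
    ContDiffAt ℝ ∞ (fun y => riemannCoord G y v w z) y := by
  have h0 := hG.contDiffAt_christoffel hy
  have h1 : ContDiffAt ℝ ∞ (fderiv ℝ (christoffel G)) y := h0.fderiv_right (by simp)
  have c : ∀ v : E4, ContDiffAt ℝ ∞ (fun _ : E4 => v) y := fun v => contDiffAt_const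
  have k : ∀ v w : E4, ContDiffAt ℝ ∞ (fun y => christoffel G y v w) y := fun v w =>
    (h0.clm_apply (c v)).clm_apply (c w)
  have k1 : ∀ u v w : E4, ContDiffAt ℝ ∞ (fun y => fderiv ℝ (christoffel G) y u v w) y :=
    fun u v w => ((h1.clm_apply (c u)).clm_apply (c v)).clm_apply (c w)
  have k2 : ∀ u v w : E4,
      ContDiffAt ℝ ∞ (fun y => christoffel G y u (christoffel G y v w)) y :=
    fun u v w => (h0.clm_apply (c u)).clm_apply (k v w)
  unfold riemannCoord
  exact (((k1 _ _ _).sub (k1 _ _ _)).add (k2 _ _ _)).sub (k2 _ _ _)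

end IsMetricOn

/-- The curvature as an endomorphism in its first argument. -/
def riemannEnd (G : E4 → E4 →L[ℝ] E4 →L[ℝ] ℝ) (y w z : E4) : E4 →ₗ[ℝ] E4 where
  toFun v := riemannCoord G y v w z
  map_add' a b := by simp [riemannCoord]; abel
  map_smul' k a := by simp [riemannCoord, smul_sub, smul_add]

theorem riemannEnd_apply (G : E4 → E4 →L[ℝ] E4 →L[ℝ] ℝ) (y v w z : E4) :
    riemannEnd G y w z v = riemannCoord G y v w z := rfl

theorem trace_eq_sum_single (L : E4 →ₗ[ℝ] E4) :
    LinearMap.trace ℝ E4 L = ∑ i : Fin 4, (L (EuclideanSpace.single i 1)) i := by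
  rw [LinearMap.trace_eq_matrix_trace ℝ (EuclideanSpace.basisFun (Fin 4) ℝ).toBasis]
  simp [Matrix.trace, LinearMap.toMatrix_apply]

/-- Frees the Ricci tensor from the standard basis, so that it can be transported by coordinate
changes and computed in orthonormal bases. -/
theorem ricciCoord_eq_trace (G : E4 → E4 →L[ℝ] E4 →L[ℝ] ℝ) (y w z : E4) :
    ricciCoord G y w z = LinearMap.trace ℝ E4 (riemannEnd G y w z) := by
  rw [ricciCoord_apply, trace_eq_sum_single]
  rfl

/-- Endomorphisms intertwined by an isomorphism have the same trace. -/
theorem trace_eq_of_intertwine {V W : Type*} [AddCommGroup V] [Module ℝ V] [AddCommGroup W]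
    [Module ℝ W] (A : V ≃ₗ[ℝ] W) {L : V →ₗ[ℝ] V} {L' : W →ₗ[ℝ] W}
    (h : ∀ v, A (L v) = L' (A v)) : LinearMap.trace ℝ V L = LinearMap.trace ℝ W L' := by
  have : L' = A.conj L := by
    ext w
    simp [LinearEquiv.conj_apply, h]
  rw [this, LinearMap.trace_conj']

/-! ### Naturality under changes of coordinates -/

/-- The coordinate expression of the pulled back form `Ψ^* G`. -/
def pullbackForm (Ψ : E4 → E4) (G : E4 → E4 →L[ℝ] E4 →L[ℝ] ℝ) (y : E4) :
    E4 →L[ℝ] E4 →L[ℝ] ℝ :=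
  (G (Ψ y)).bilinearComp (fderiv ℝ Ψ y) (fderiv ℝ Ψ y)

theorem pullbackForm_apply (Ψ : E4 → E4) (G : E4 → E4 →L[ℝ] E4 →L[ℝ] ℝ) (y v w : E4) :
    pullbackForm Ψ G y v w = G (Ψ y) (fderiv ℝ Ψ y v) (fderiv ℝ Ψ y w) := rfl

/-- A smooth map of an open set `s'` to `s` with invertible derivative. -/
structure IsCoordChange (Ψ : E4 → E4) (s' s : Set E4) : Prop where
  isOpen : IsOpen s'
  mapsTo : Set.MapsTo Ψ s' s
  contDiffOn : ContDiffOn ℝ ∞ Ψ s'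
  inv : ∀ y ∈ s', (fderiv ℝ Ψ y).IsInvertible

namespace IsCoordChange

variable {Ψ : E4 → E4} {s' s : Set E4} (hΨ : IsCoordChange Ψ s' s)
include hΨ

theorem contDiffAt {y : E4} (hy : y ∈ s') : ContDiffAt ℝ ∞ Ψ y :=
  hΨ.contDiffOn.contDiffAt (hΨ.isOpen.mem_nhds hy)

theorem hasFDerivAt {y : E4} (hy : y ∈ s') : HasFDerivAt Ψ (fderiv ℝ Ψ y) y :=
  ((hΨ.contDiffAt hy).differentiableAt (by simp)).hasFDerivAt

theorem contDiffAt_fderiv {y : E4} (hy : y ∈ s') : ContDiffAt ℝ ∞ (fderiv ℝ Ψ) y :=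
  (hΨ.contDiffAt hy).fderiv_right (by simp)

theorem hasFDerivAt_fderiv {y : E4} (hy : y ∈ s') :
    HasFDerivAt (fderiv ℝ Ψ) (fderiv ℝ (fderiv ℝ Ψ) y) y :=
  ((hΨ.contDiffAt_fderiv hy).differentiableAt (by simp)).hasFDerivAt

theorem hasFDerivAt_fderiv₂ {y : E4} (hy : y ∈ s') :
    HasFDerivAt (fderiv ℝ (fderiv ℝ Ψ)) (fderiv ℝ (fderiv ℝ (fderiv ℝ Ψ)) y) y :=
  (((hΨ.contDiffAt_fderiv hy).fderiv_right (m := ∞) (by simp)).differentiableAt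
    (by simp)).hasFDerivAt

theorem second_symm {y : E4} (hy : y ∈ s') (v w : E4) :
    fderiv ℝ (fderiv ℝ Ψ) y v w = fderiv ℝ (fderiv ℝ Ψ) y w v := by
  have := (hΨ.contDiffAt hy).isSymmSndFDerivAt (by simp [two_le_infty])
  exact this v w

theorem third_symm {y : E4} (hy : y ∈ s') (u v w : E4) :
    fderiv ℝ (fderiv ℝ (fderiv ℝ Ψ)) y u v w = fderiv ℝ (fderiv ℝ (fderiv ℝ Ψ)) y v u w := by
  have := (hΨ.contDiffAt_fderiv hy).isSymmSndFDerivAt (by simp [two_le_infty])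
  rw [this u v]

variable {G : E4 → E4 →L[ℝ] E4 →L[ℝ] ℝ} (hG : IsMetricOn G s)
include hG

theorem isMetricOn_pullbackForm : IsMetricOn (pullbackForm Ψ G) s' where
  isOpen := hΨ.isOpen
  contDiffOn := by
    intro y hy
    apply ContDiffAt.contDiffWithinAt
    have h1 : ContDiffAt ℝ ∞ (fun z => G (Ψ z)) y :=
      (hG.contDiffAt (hΨ.mapsTo hy)).comp y (hΨ.contDiffAt hy)
    have h2 := hΨ.contDiffAt_fderiv hy
    have : pullbackForm Ψ G = fun z =>
        ((ContinuousLinearMap.compL ℝ E4 E4 ℝ).flip (fderiv ℝ Ψ z)).comp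
          ((G (Ψ z)).comp (fderiv ℝ Ψ z)) := by
      funext z; ext v w; rfl
    rw [this]
    exact (((ContinuousLinearMap.compL ℝ E4 E4 ℝ).flip.contDiff.contDiffAt).comp y h2).clm_comp
      (h1.clm_comp h2)
  symm y hy v w := hG.symm _ (hΨ.mapsTo hy) _ _
  inv y hy := by
    refine isInvertible_of_injective finrank_dual_E4 fun v w h => ?_
    apply (hΨ.inv y hy).injective
    apply hG.ext_apply (hΨ.mapsTo hy)
    intro z
    obtain ⟨z, rfl⟩ := (hΨ.inv y hy).surjective z
    exact congrArg (fun L : E4 →L[ℝ] ℝ => L z) h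

theorem fderiv_pullbackForm {y : E4} (hy : y ∈ s') (a v w : E4) :
    fderiv ℝ (pullbackForm Ψ G) y a v w =
      fderiv ℝ G (Ψ y) (fderiv ℝ Ψ y a) (fderiv ℝ Ψ y v) (fderiv ℝ Ψ y w)
      + G (Ψ y) (fderiv ℝ (fderiv ℝ Ψ) y a v) (fderiv ℝ Ψ y w)
      + G (Ψ y) (fderiv ℝ Ψ y v) (fderiv ℝ (fderiv ℝ Ψ) y a w) := by
  have hm := hΨ.isMetricOn_pullbackForm hG
  rw [← fderiv_apply₂ (hm.differentiableAt hy)]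
  have h1 := ((hG.differentiableAt (hΨ.mapsTo hy)).hasFDerivAt.comp y (hΨ.hasFDerivAt hy))
  have h2 := hΨ.hasFDerivAt_fderiv hy
  have h3 : HasFDerivAt (fun z => pullbackForm Ψ G z v w) _ y :=
    (h1.clm_apply (h2.clm_apply (hasFDerivAt_const v y))).clm_apply
      (h2.clm_apply (hasFDerivAt_const w y))
  rw [h3.fderiv]
  simp
  ring

/-- The usual inhomogeneous transformation law. Transporting the connection by `Ψ`, with the term
`D²Ψ`, gives a symmetric connection compatible with the pulled back form, and uniqueness applies. -/
theorem fderiv_christoffel_pullbackForm {y : E4} (hy : y ∈ s') (v w : E4) :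
    fderiv ℝ Ψ y (christoffel (pullbackForm Ψ G) y v w) =
      christoffel G (Ψ y) (fderiv ℝ Ψ y v) (fderiv ℝ Ψ y w) + fderiv ℝ (fderiv ℝ Ψ) y v w := by
  have hm := hΨ.isMetricOn_pullbackForm hG
  have hy' := hΨ.mapsTo hy
  have key := hm.eq_christoffel hy (C := fun v w => (fderiv ℝ Ψ y).inverse
    (christoffel G (Ψ y) (fderiv ℝ Ψ y v) (fderiv ℝ Ψ y w) + fderiv ℝ (fderiv ℝ Ψ) y v w))
    (fun v w => by rw [hG.christoffel_symm hy', hΨ.second_symm hy])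
    (fun a v w => by
      rw [hΨ.fderiv_pullbackForm hG hy, pullbackForm_apply, pullbackForm_apply,
        (hΨ.inv y hy).self_apply_inverse, (hΨ.inv y hy).self_apply_inverse, hG.fderiv_eq hy']
      simp only [map_add, add_apply]
      ring) v w
  rw [← key, (hΨ.inv y hy).self_apply_inverse]

/-- The transformation law of the Christoffel symbols is differentiated once; antisymmetrizing in
`u`, `v` removes `D³Ψ`, and the terms in `D²Ψ` cancel against those from the quadratic part. -/
theorem fderiv_riemannCoord_pullbackForm {y : E4} (hy : y ∈ s') (u v w : E4) :
    fderiv ℝ Ψ y (riemannCoord (pullbackForm Ψ G) y u v w) =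
      riemannCoord G (Ψ y) (fderiv ℝ Ψ y u) (fderiv ℝ Ψ y v) (fderiv ℝ Ψ y w) := by
  have hm := hΨ.isMetricOn_pullbackForm hG
  have hy' := hΨ.mapsTo hy
  have e1 : ∀ u v w : E4,
      fderiv ℝ (fderiv ℝ Ψ) y u (christoffel (pullbackForm Ψ G) y v w)
        + fderiv ℝ Ψ y (fderiv ℝ (christoffel (pullbackForm Ψ G)) y u v w) =
      fderiv ℝ (christoffel G) (Ψ y) (fderiv ℝ Ψ y u) (fderiv ℝ Ψ y v) (fderiv ℝ Ψ y w)
        + christoffel G (Ψ y) (fderiv ℝ (fderiv ℝ Ψ) y u v) (fderiv ℝ Ψ y w)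
        + christoffel G (Ψ y) (fderiv ℝ Ψ y v) (fderiv ℝ (fderiv ℝ Ψ) y u w)
        + fderiv ℝ (fderiv ℝ (fderiv ℝ Ψ)) y u v w := by
    intro u v w
    have d1 := ((hm.contDiffAt_christoffel hy).differentiableAt (by simp)).hasFDerivAt
    have d2 := ((hG.contDiffAt_christoffel hy').differentiableAt (by simp)).hasFDerivAt.comp y
      (hΨ.hasFDerivAt hy)
    have d3 := hΨ.hasFDerivAt_fderiv hy
    have d4 := hΨ.hasFDerivAt_fderiv₂ hy
    have c := fun v : E4 => hasFDerivAt_const (𝕜 := ℝ) v y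
    have L : HasFDerivAt
        (fun z => fderiv ℝ Ψ z (christoffel (pullbackForm Ψ G) z v w)) _ y :=
      d3.clm_apply ((d1.clm_apply (c v)).clm_apply (c w))
    have R : HasFDerivAt (fun z =>
        christoffel G (Ψ z) (fderiv ℝ Ψ z v) (fderiv ℝ Ψ z w) + fderiv ℝ (fderiv ℝ Ψ) z v w) _ y :=
      ((d2.clm_apply (d3.clm_apply (c v))).clm_apply (d3.clm_apply (c w))).add
        ((d4.clm_apply (c v)).clm_apply (c w))
    have E : (fun z => fderiv ℝ Ψ z (christoffel (pullbackForm Ψ G) z v w)) =ᶠ[𝓝 y] fun z =>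
        christoffel G (Ψ z) (fderiv ℝ Ψ z v) (fderiv ℝ Ψ z w)
          + fderiv ℝ (fderiv ℝ Ψ) z v w := by
      filter_upwards [hm.eventually_mem hy] with z hz
        using hΨ.fderiv_christoffel_pullbackForm hG hz v w
    have := congrArg (fun L : E4 →L[ℝ] E4 => L u) (L.unique (R.congr_of_eventuallyEq E))
    simp at this
    rw [add_comm, this]
    abel
  have e2 := fun v w => hΨ.fderiv_christoffel_pullbackForm hG hy v w
  have e3 : ∀ u v w : E4, christoffel G (Ψ y) (fderiv ℝ Ψ y u)
      (christoffel G (Ψ y) (fderiv ℝ Ψ y v) (fderiv ℝ Ψ y w)) =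
      fderiv ℝ Ψ y (christoffel (pullbackForm Ψ G) y u (christoffel (pullbackForm Ψ G) y v w))
      - fderiv ℝ (fderiv ℝ Ψ) y u (christoffel (pullbackForm Ψ G) y v w)
      - christoffel G (Ψ y) (fderiv ℝ Ψ y u) (fderiv ℝ (fderiv ℝ Ψ) y v w) := by
    intro u v w
    rw [e2 u, e2 v w, map_add]
    abel
  have e4 : ∀ u v w : E4, fderiv ℝ (christoffel G) (Ψ y) (fderiv ℝ Ψ y u) (fderiv ℝ Ψ y v)
      (fderiv ℝ Ψ y w) = fderiv ℝ (fderiv ℝ Ψ) y u (christoffel (pullbackForm Ψ G) y v w)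
        + fderiv ℝ Ψ y (fderiv ℝ (christoffel (pullbackForm Ψ G)) y u v w)
        - christoffel G (Ψ y) (fderiv ℝ (fderiv ℝ Ψ) y u v) (fderiv ℝ Ψ y w)
        - christoffel G (Ψ y) (fderiv ℝ Ψ y v) (fderiv ℝ (fderiv ℝ Ψ) y u w)
        - fderiv ℝ (fderiv ℝ (fderiv ℝ Ψ)) y u v w := by
    intro u v w
    rw [e1 u v w]
    abel
  unfold riemannCoord
  rw [e3, e3, e4, e4, hΨ.second_symm hy v u, hΨ.third_symm hy v u]
  simp only [map_add, map_sub]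
  abel

theorem ricciCoord_pullbackForm {y : E4} (hy : y ∈ s') (v w : E4) :
    ricciCoord (pullbackForm Ψ G) y v w =
      ricciCoord G (Ψ y) (fderiv ℝ Ψ y v) (fderiv ℝ Ψ y w) := by
  obtain ⟨A, hA⟩ := hΨ.inv y hy
  rw [ricciCoord_eq_trace, ricciCoord_eq_trace]
  refine trace_eq_of_intertwine A.toLinearEquiv fun u => ?_
  have hA' : ∀ u, A u = fderiv ℝ Ψ y u := fun u => by rw [← hA]; rfl
  simp only [ContinuousLinearEquiv.coe_toLinearEquiv, riemannEnd_apply, hA',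
    hΨ.fderiv_riemannCoord_pullbackForm hG hy]

/-- Differentiating the relation `DΨ · U' = U ∘ Ψ` produces a term in `D²Ψ`, the one that the
Christoffel symbols compensate. -/
theorem covDerivCoord_pullbackForm {U U' : E4 → E4} {y : E4} (hy : y ∈ s')
    (hU : DifferentiableAt ℝ U (Ψ y)) (hU' : DifferentiableAt ℝ U' y)
    (h : ∀ᶠ z in 𝓝 y, fderiv ℝ Ψ z (U' z) = U (Ψ z)) (v : E4) :
    fderiv ℝ Ψ y (covDerivCoord (pullbackForm Ψ G) U' y v) =
      covDerivCoord G U (Ψ y) (fderiv ℝ Ψ y v) := by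
  have R := hU.hasFDerivAt.comp y (hΨ.hasFDerivAt hy)
  have L := (hΨ.hasFDerivAt_fderiv hy).clm_apply hU'.hasFDerivAt
  have := congrArg (fun L : E4 →L[ℝ] E4 => L v) (L.unique (R.congr_of_eventuallyEq h))
  simp at this
  simp only [covDerivCoord, add_apply, ContinuousLinearMap.flip_apply, map_add,
    hΨ.fderiv_christoffel_pullbackForm hG hy, ← this, h.self_of_nhds]
  abel

end IsCoordChange

/-! ### Orthonormal bases -/

/-- The basis `e` is orthonormal for the form `B`, the products `B (e i) (e i) = η i` being
`1` or `-1`. -/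
structure IsOrthonormalBasis {V : Type*} [AddCommGroup V] [Module ℝ V] [TopologicalSpace V]
    (B : V →L[ℝ] V →L[ℝ] ℝ) (e : Module.Basis (Fin 4) ℝ V) (η : Fin 4 → ℝ) : Prop where
  sq : ∀ i, η i * η i = 1
  apply : ∀ i j, B (e i) (e j) = if i = j then η i else 0

namespace IsOrthonormalBasis

variable {V : Type*} [AddCommGroup V] [Module ℝ V] [TopologicalSpace V]
  {B : V →L[ℝ] V →L[ℝ] ℝ} {e : Module.Basis (Fin 4) ℝ V} {η : Fin 4 → ℝ}
  (h : IsOrthonormalBasis B e η)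
include h

theorem repr_eq (v : V) (i : Fin 4) : e.repr v i = η i * B v (e i) := by
  have hB : B v (e i) = e.repr v i * η i := by
    conv_lhs => rw [← e.sum_repr v]
    simp only [map_sum, map_smul, sum_apply, smul_apply, h.apply, smul_eq_mul]
    simp
  rw [hB, mul_left_comm, h.sq, mul_one]

theorem sum_eq (v : V) : ∑ i, (η i * B v (e i)) • e i = v := by
  conv_rhs => rw [← e.sum_repr v]
  simp [h.repr_eq]

theorem trace_eq (L : V →ₗ[ℝ] V) : LinearMap.trace ℝ V L = ∑ i, η i * B (L (e i)) (e i) := by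
  rw [LinearMap.trace_eq_matrix_trace ℝ e]
  simp [Matrix.trace, LinearMap.toMatrix_apply, h.repr_eq]

/-- Contraction of an index: it collapses the divergence sums of the Bianchi identity into one
evaluation at `v`. -/
theorem sum_mul (v : V) (ℓ : V →L[ℝ] ℝ) :
    ∑ i, η i * (B v (e i) * ℓ (e i)) = ℓ v := by
  conv_rhs => rw [← h.sum_eq v]
  simp [mul_assoc]

theorem injective : Function.Injective B := by
  intro v w hvw
  rw [← h.sum_eq v, ← h.sum_eq w, hvw]

end IsOrthonormalBasis

/-! ### Symmetries of the curvature and Bianchi identities. -/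

namespace IsMetricOn

variable {G : E4 → E4 →L[ℝ] E4 →L[ℝ] ℝ} {s : Set E4} (hG : IsMetricOn G s)
include hG

theorem hasFDerivAt_christoffel {y : E4} (hy : y ∈ s) :
    HasFDerivAt (christoffel G) (fderiv ℝ (christoffel G) y) y :=
  ((hG.contDiffAt_christoffel hy).differentiableAt (by simp)).hasFDerivAt

theorem hasFDerivAt_fderiv_christoffel {y : E4} (hy : y ∈ s) :
    HasFDerivAt (fderiv ℝ (christoffel G)) (fderiv ℝ (fderiv ℝ (christoffel G)) y) y :=
  (((hG.contDiffAt_christoffel hy).fderiv_right (m := ∞) (by simp)).differentiableAt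
    (by simp)).hasFDerivAt

theorem hasFDerivAt_riemannCoord {y : E4} (hy : y ∈ s) (v w z : E4) :
    HasFDerivAt (fun y => riemannCoord G y v w z)
      (fderiv ℝ (fun y => riemannCoord G y v w z) y) y :=
  ((hG.contDiffAt_riemannCoord hy v w z).differentiableAt (by simp)).hasFDerivAt

omit hG in
theorem riemannCoord_swap (y v w z : E4) : riemannCoord G y v w z = -riemannCoord G y w v z := by
  unfold riemannCoord
  abel

/-- The first Bianchi identity. -/
theorem first_bianchi {y : E4} (hy : y ∈ s) (v w z : E4) :
    riemannCoord G y v w z + riemannCoord G y w z v + riemannCoord G y z v w = 0 := by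
  have h : ∀ a v w, fderiv ℝ (christoffel G) y a v w = fderiv ℝ (christoffel G) y a w v := by
    intro a v w
    have c := fun v : E4 => hasFDerivAt_const (𝕜 := ℝ) v y
    have d := fun v w => ((hG.hasFDerivAt_christoffel hy).clm_apply (c v)).clm_apply (c w)
    have E : (fun z => christoffel G z v w) =ᶠ[𝓝 y] fun z => christoffel G z w v := by
      filter_upwards [hG.eventually_mem hy] with z hz using hG.christoffel_symm hz v w
    have := congrArg (fun L : E4 →L[ℝ] E4 => L a)
      ((d v w).unique ((d w v).congr_of_eventuallyEq E))
    simpa using this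
  unfold riemannCoord
  rw [h v w z, h w v z, h z v w, hG.christoffel_symm hy w z, hG.christoffel_symm hy v z,
    hG.christoffel_symm hy v w]
  abel

/-- The curvature endomorphisms are skew. -/
theorem riemannCoord_skew {y : E4} (hy : y ∈ s) (v w z e : E4) :
    G y (riemannCoord G y v w z) e = -G y (riemannCoord G y v w e) z := by
  -- Second derivatives of `G`, from metricity differentiated once more. They commute, and the
  -- antisymmetric part in `v`, `w` of the right side is the required identity.
  have key : ∀ v w : E4, fderiv ℝ (fderiv ℝ G) y v w z e =
      G y (christoffel G y v (christoffel G y w z)) e + G y (christoffel G y w z)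
        (christoffel G y v e) + G y (fderiv ℝ (christoffel G) y v w z) e
      + (G y (christoffel G y v z) (christoffel G y w e)
        + G y z (christoffel G y v (christoffel G y w e))
        + G y z (fderiv ℝ (christoffel G) y v w e)) := by
    intro v w
    have c := fun v : E4 => hasFDerivAt_const (𝕜 := ℝ) v y
    have d1 := (hG.differentiableAt hy).hasFDerivAt
    have d2 := hG.hasFDerivAt_christoffel hy
    have d3 : HasFDerivAt (fderiv ℝ G) (fderiv ℝ (fderiv ℝ G) y) y :=
      (((hG.contDiffAt hy).fderiv_right (m := ∞) (by simp)).differentiableAt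
        (by simp)).hasFDerivAt
    have L : HasFDerivAt (fun x => fderiv ℝ G x w z e) _ y :=
      ((d3.clm_apply (c w)).clm_apply (c z)).clm_apply (c e)
    have R : HasFDerivAt (fun x => G x (christoffel G x w z) e + G x z (christoffel G x w e)) _ y :=
      ((d1.clm_apply ((d2.clm_apply (c w)).clm_apply (c z))).clm_apply (c e)).add
        ((d1.clm_apply (c z)).clm_apply ((d2.clm_apply (c w)).clm_apply (c e)))
    have E : (fun x => fderiv ℝ G x w z e) =ᶠ[𝓝 y]
        fun x => G x (christoffel G x w z) e + G x z (christoffel G x w e) := by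
      filter_upwards [hG.eventually_mem hy] with x hx using hG.fderiv_eq hx w z e
    have := congrArg (fun L : E4 →L[ℝ] ℝ => L v) (L.unique (R.congr_of_eventuallyEq E))
    simp [hG.fderiv_eq hy] at this
    rw [this]
    ring
  have sym : fderiv ℝ (fderiv ℝ G) y v w = fderiv ℝ (fderiv ℝ G) y w v :=
    (hG.contDiffAt hy).isSymmSndFDerivAt (by simp [two_le_infty]) v w
  have h1 := key v w
  rw [sym, key w v] at h1
  have h2 := hG.symm y hy (riemannCoord G y v w e) z
  rw [h2]
  unfold riemannCoord
  simp only [map_add, map_sub, add_apply, sub_apply]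
  linarith

theorem trace_riemannCoord {y : E4} (hy : y ∈ s) (e : Module.Basis (Fin 4) ℝ E4)
    (η : Fin 4 → ℝ) (v w : E4) :
    ∑ i, η i * G y (riemannCoord G y v w (e i)) (e i) = 0 := by
  refine Finset.sum_eq_zero fun i _ => ?_
  have := hG.riemannCoord_skew hy v w (e i) (e i)
  rw [show G y (riemannCoord G y v w (e i)) (e i) = 0 by linarith, mul_zero]

/-- Tracing the first Bianchi identity expresses the antisymmetric part of Ricci through the trace
of `R(v, w)`, which is zero because `R(v, w)` is skew. -/
theorem ricciCoord_symm {y : E4} (hy : y ∈ s) {e : Module.Basis (Fin 4) ℝ E4} {η : Fin 4 → ℝ}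
    (he : IsOrthonormalBasis (G y) e η) (v w : E4) : ricciCoord G y v w = ricciCoord G y w v := by
  have h := hG.trace_riemannCoord hy e η v w
  rw [ricciCoord_eq_trace, ricciCoord_eq_trace, he.trace_eq, he.trace_eq, ← sub_eq_zero,
    ← Finset.sum_sub_distrib, ← neg_eq_zero, ← h, ← Finset.sum_neg_distrib]
  refine Finset.sum_congr rfl fun i _ => ?_
  have := congrArg (fun x => G y x (e i)) (hG.first_bianchi hy (e i) v w)
  simp only [riemannEnd_apply, map_add, add_apply, map_zero, zero_apply,
    riemannCoord_swap y w (e i) v, map_neg, neg_apply] at this ⊢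
  linear_combination (-η i) * this

section Normal

variable {y : E4} (hy : y ∈ s) (h0 : christoffel G y = 0)
include hy h0

/-- The terms quadratic in the Christoffel symbols have zero derivative where these symbols vanish.
-/
theorem fderiv_riemannCoord (a b c d : E4) :
    fderiv ℝ (fun x => riemannCoord G x b c d) y a =
      fderiv ℝ (fderiv ℝ (christoffel G)) y a b c d
        - fderiv ℝ (fderiv ℝ (christoffel G)) y a c b d := by
  have k := fun v : E4 => hasFDerivAt_const (𝕜 := ℝ) v y
  have d2 := hG.hasFDerivAt_christoffel hy
  have d3 := hG.hasFDerivAt_fderiv_christoffel hy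
  have e1 := fun b c => ((d3.clm_apply (k b)).clm_apply (k c)).clm_apply (k d)
  have e2 := fun b c => (d2.clm_apply (k b)).clm_apply ((d2.clm_apply (k c)).clm_apply (k d))
  have R : HasFDerivAt (fun x => riemannCoord G x b c d) _ y :=
    (((e1 b c).sub (e1 c b)).add (e2 b c)).sub (e2 c b)
  rw [R.fderiv]
  simp [h0]

/-- The second Bianchi identity, at the origin of normal coordinates. -/
theorem second_bianchi (a b c d : E4) :
    fderiv ℝ (fun x => riemannCoord G x b c d) y a
      + fderiv ℝ (fun x => riemannCoord G x c a d) y b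
      + fderiv ℝ (fun x => riemannCoord G x a b d) y c = 0 := by
  -- Commuting second derivatives of `christoffel G` cancel the six terms in pairs.
  have sym : ∀ u v, fderiv ℝ (fderiv ℝ (christoffel G)) y u v =
      fderiv ℝ (fderiv ℝ (christoffel G)) y v u := fun u v =>
    (hG.contDiffAt_christoffel hy).isSymmSndFDerivAt (by simp [two_le_infty]) u v
  simp only [hG.fderiv_riemannCoord hy h0]
  rw [sym b a, sym c a, sym c b]
  abel

theorem fderiv_eq_zero_of_christoffel : fderiv ℝ G y = 0 := by
  ext a v w
  simp [hG.fderiv_eq hy, h0]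

theorem fderiv_riemannCoord_skew (a b c d e : E4) :
    G y (fderiv ℝ (fun x => riemannCoord G x b c d) y a) e =
      -G y (fderiv ℝ (fun x => riemannCoord G x b c e) y a) d := by
  have k := fun v : E4 => hasFDerivAt_const (𝕜 := ℝ) v y
  have d1 := (hG.differentiableAt hy).hasFDerivAt
  have L := fun d e : E4 =>
    (d1.clm_apply (hG.hasFDerivAt_riemannCoord hy b c d)).clm_apply (k e)
  have E : (fun x => G x (riemannCoord G x b c d) e) =ᶠ[𝓝 y]
      fun x => -G x (riemannCoord G x b c e) d := by
    filter_upwards [hG.eventually_mem hy] with x hx using hG.riemannCoord_skew hx b c d e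
  have := congrArg (fun L : E4 →L[ℝ] ℝ => L a)
    ((L d e).unique ((L e d).neg.congr_of_eventuallyEq E))
  simpa [hG.fderiv_eq_zero_of_christoffel hy h0] using this

variable {e : Module.Basis (Fin 4) ℝ E4} {η : Fin 4 → ℝ} (he : IsOrthonormalBasis (G y) e η)
include he

theorem fderiv_ricciCoord (a c d : E4) :
    fderiv ℝ (fun x => ricciCoord G x c d) y a =
      ∑ i, η i * G y (fderiv ℝ (fun x => riemannCoord G x (e i) c d) y a) (e i) := by
  -- The derivative of the curvature is linear in the slot `b`. Its trace may therefore be taken in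
  -- a basis orthonormal at `y` alone, with no need of a moving frame.
  let L : E4 →ₗ[ℝ] E4 :=
    { toFun := fun b => fderiv ℝ (fun x => riemannCoord G x b c d) y a
      map_add' := fun b b' => by simp [hG.fderiv_riemannCoord hy h0]; abel
      map_smul' := fun k b => by simp [hG.fderiv_riemannCoord hy h0, smul_sub] }
  have h1 := he.trace_eq L
  rw [trace_eq_sum_single] at h1
  have h2 : HasFDerivAt
      (fun x => ∑ i : Fin 4, (riemannCoord G x (EuclideanSpace.single i 1) c d) i) _ y :=
    HasFDerivAt.fun_sum (u := Finset.univ) fun i _ =>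
      (EuclideanSpace.proj i : E4 →L[ℝ] ℝ).hasFDerivAt.comp y
        (hG.hasFDerivAt_riemannCoord hy (EuclideanSpace.single i 1) c d)
  rw [show (fun x => ricciCoord G x c d) = _ from funext fun x => ricciCoord_apply G x c d,
    h2.fderiv]
  simpa [L] using h1

/-- The contracted Bianchi identity, at the origin of normal coordinates. -/
theorem contracted_bianchi (c : E4) :
    ∑ j, η j * fderiv ℝ (fun x => ricciCoord G x (e j) (e j)) y c =
      2 * ∑ j, η j * fderiv ℝ (fun x => ricciCoord G x c (e j)) y (e j) := by
  -- The second Bianchi identity for `c`, `e i`, `e j` applied to `e j` and paired with `e i`: the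
  -- two skew symmetries turn its last two terms into divergences of Ricci, equal after exchanging
  -- `i` and `j`.
  have h1 : ∑ j, η j * fderiv ℝ (fun x => ricciCoord G x (e j) (e j)) y c =
      ∑ j, ∑ i, (η j * (η i * G y (fderiv ℝ (fun x => riemannCoord G x (e j) c (e i)) y (e i))
          (e j)) + η j * (η i * G y (fderiv ℝ (fun x => riemannCoord G x (e i) c (e j)) y (e j))
          (e i))) := by
    refine Finset.sum_congr rfl fun j _ => ?_
    rw [hG.fderiv_ricciCoord hy h0 he, Finset.mul_sum]
    refine Finset.sum_congr rfl fun i _ => ?_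
    have b := congrArg (fun x => G y x (e i)) (hG.second_bianchi hy h0 c (e i) (e j) (e j))
    have s1 := hG.fderiv_riemannCoord_skew hy h0 (e i) (e j) c (e j) (e i)
    have s2 : G y (fderiv ℝ (fun x => riemannCoord G x c (e i) (e j)) y (e j)) (e i) =
        -G y (fderiv ℝ (fun x => riemannCoord G x (e i) c (e j)) y (e j)) (e i) := by
      simp only [hG.fderiv_riemannCoord hy h0, map_sub, sub_apply]
      ring
    simp only [map_add, add_apply, map_zero, zero_apply] at b
    linear_combination η j * η i * (b - s1 - s2)
  rw [h1]
  simp only [Finset.sum_add_distrib, hG.fderiv_ricciCoord hy h0 he, Finset.mul_sum]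
  rw [Finset.sum_comm, ← Finset.sum_add_distrib]
  refine Finset.sum_congr rfl fun j _ => ?_
  rw [← Finset.sum_add_distrib]
  refine Finset.sum_congr rfl fun i _ => ?_
  ring

/-- Conservation of energy for a perfect fluid whose energy density and pressure are constant
along the flow, at the origin of normal coordinates. -/
theorem trace_fderiv_eq_zero {U : E4 → E4} {q l : E4 → ℝ} (hU : DifferentiableAt ℝ U y)
    (hq : DifferentiableAt ℝ q y) (hl : DifferentiableAt ℝ l y)
    (hunit : ∀ᶠ x in 𝓝 y, G x (U x) (U x) = -1)
    (hric : ∀ᶠ x in 𝓝 y, ∀ v w, ricciCoord G x v w =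
      q x * (G x (U x) v * G x (U x) w) + l x * G x v w)
    (hqU : fderiv ℝ q y (U y) = 0) (hlU : fderiv ℝ l y (U y) = 0) (hq0 : q y ≠ 0) :
    LinearMap.trace ℝ E4 (fderiv ℝ U y).toLinearMap = 0 := by
  have k := fun v : E4 => hasFDerivAt_const (𝕜 := ℝ) v y
  have dG := (hG.differentiableAt hy).hasFDerivAt
  rw [hG.fderiv_eq_zero_of_christoffel hy h0] at dG
  have dU := hU.hasFDerivAt
  have u0 := hunit.self_of_nhds
  -- The derivative of the normalization: every derivative of `U` is orthogonal to `U`.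
  have acc : ∀ a, G y (fderiv ℝ U y a) (U y) = 0 := by
    intro a
    have L : HasFDerivAt (fun x => G x (U x) (U x)) _ y := (dG.clm_apply dU).clm_apply dU
    have := congrArg (fun L : E4 →L[ℝ] ℝ => L a)
      (L.unique ((hasFDerivAt_const (-1 : ℝ) y).congr_of_eventuallyEq hunit))
    simp [hG.symm y hy (U y)] at this
    linarith
  have D : ∀ a v w, fderiv ℝ (fun x => ricciCoord G x v w) y a =
      fderiv ℝ q y a * (G y (U y) v * G y (U y) w)
      + q y * (G y (fderiv ℝ U y a) v * G y (U y) w + G y (U y) v * G y (fderiv ℝ U y a) w)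
      + fderiv ℝ l y a * G y v w := by
    intro a v w
    have e := fun v => (dG.clm_apply dU).clm_apply (k v)
    have L : HasFDerivAt (fun x => q x * (G x (U x) v * G x (U x) w) + l x * G x v w) _ y :=
      (hq.hasFDerivAt.mul ((e v).mul (e w))).add
        (hl.hasFDerivAt.mul ((dG.clm_apply (k v)).clm_apply (k w)))
    have E : (fun x => ricciCoord G x v w) =ᶠ[𝓝 y]
        fun x => q x * (G x (U x) v * G x (U x) w) + l x * G x v w := by
      filter_upwards [hric] with x hx using hx v w
    rw [E.fderiv_eq, L.fderiv]
    simp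
    ring
  have cb := hG.contracted_bianchi hy h0 he (U y)
  have hs := hG.symm y hy
  have S := fun v ℓ => he.sum_mul v ℓ
  -- The derivative of the scalar curvature along the flow. What remains is a multiple of the
  -- product of `U` and its acceleration.
  have s1 : ∑ j, η j * fderiv ℝ (fun x => ricciCoord G x (e j) (e j)) y (U y) = 0 := by
    have : ∀ j, η j * fderiv ℝ (fun x => ricciCoord G x (e j) (e j)) y (U y) =
        2 * q y * (η j * (G y (fderiv ℝ U y (U y)) (e j) * G y (U y) (e j))) := by
      intro j
      rw [D, hqU, hlU]
      ring
    simp only [this]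
    rw [← Finset.mul_sum, S, hs, acc, mul_zero]
  -- The divergence of Ricci along `U`: `q` and `l` enter only through their derivatives along `U`,
  -- leaving `-q` times the divergence of `U`.
  have s2 : ∑ j, η j * fderiv ℝ (fun x => ricciCoord G x (U y) (e j)) y (e j) =
      -(q y * LinearMap.trace ℝ E4 (fderiv ℝ U y).toLinearMap) := by
    have : ∀ j, η j * fderiv ℝ (fun x => ricciCoord G x (U y) (e j)) y (e j) =
        -(η j * (G y (U y) (e j) * fderiv ℝ q y (e j)))
        + (-(q y * (η j * G y (fderiv ℝ U y (e j)) (e j))))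
        + η j * (G y (U y) (e j) * fderiv ℝ l y (e j)) := by
      intro j
      rw [D, acc, u0]
      ring
    simp only [this]
    rw [Finset.sum_add_distrib, Finset.sum_add_distrib, Finset.sum_neg_distrib,
      Finset.sum_neg_distrib, ← Finset.mul_sum, S, S, hqU, hlU, he.trace_eq]
    simp
  rw [s1, s2] at cb
  have : q y * LinearMap.trace ℝ E4 (fderiv ℝ U y).toLinearMap = 0 := by linarith
  exact (mul_eq_zero.mp this).resolve_left hq0

end Normal

end IsMetricOn

/-! ### Normal coordinates to second order and conservation of energy. -/

/-- The map `w ↦ y + w - ½ Γ(w, w)`, whose inverse gives normal coordinates at `y` to second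
order. -/
def normalMap (G : E4 → E4 →L[ℝ] E4 →L[ℝ] ℝ) (y w : E4) : E4 :=
  y + w - (1 / 2 : ℝ) • christoffel G y w w

theorem isOpen_isInvertible : IsOpen {f : E4 →L[ℝ] E4 | f.IsInvertible} := by
  have : {f : E4 →L[ℝ] E4 | f.IsInvertible} =
      Set.range ((↑) : (E4 ≃L[ℝ] E4) → E4 →L[ℝ] E4) := rfl
  rw [this]
  exact ContinuousLinearEquiv.isOpen

namespace IsMetricOn

variable {G : E4 → E4 →L[ℝ] E4 →L[ℝ] ℝ} {s : Set E4} (hG : IsMetricOn G s)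
  {y : E4} (hy : y ∈ s)

theorem contDiff_normalMap (G : E4 → E4 →L[ℝ] E4 →L[ℝ] ℝ) (y : E4) :
    ContDiff ℝ ∞ (normalMap G y) := by
  unfold normalMap
  exact (contDiff_const.add contDiff_id).sub
    ((((christoffel G y).contDiff.clm_apply contDiff_id)).const_smul (1 / 2 : ℝ))

include hG hy

theorem fderiv_normalMap : fderiv ℝ (normalMap G y) = fun w =>
    ContinuousLinearMap.id ℝ E4 - christoffel G y w := by
  funext w
  have h1 : HasFDerivAt (fun w => christoffel G y w w) _ w :=
    (christoffel G y).hasFDerivAt.clm_apply (hasFDerivAt_id w)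
  have h2 : HasFDerivAt (normalMap G y) _ w :=
    ((hasFDerivAt_id w).const_add y).sub (h1.const_smul (1 / 2 : ℝ))
  rw [h2.fderiv]
  ext1 v
  have := hG.christoffel_symm hy v w
  simp only [one_div, sub_apply, ContinuousLinearMap.id_apply, smul_apply, add_apply,
    ContinuousLinearMap.comp_apply, ContinuousLinearMap.flip_apply, this]
  rw [← two_smul ℝ (christoffel G y w v), smul_smul]
  norm_num

theorem fderiv_fderiv_normalMap (w : E4) :
    fderiv ℝ (fderiv ℝ (normalMap G y)) w = -christoffel G y := by
  rw [hG.fderiv_normalMap hy]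
  have := ((christoffel G y).hasFDerivAt (x := w)).const_sub (ContinuousLinearMap.id ℝ E4)
  exact this.fderiv

omit hy in
theorem isCoordChange_normalMap : IsCoordChange (normalMap G y)
    (normalMap G y ⁻¹' s ∩ fderiv ℝ (normalMap G y) ⁻¹' {f | f.IsInvertible}) s where
  isOpen := by
    have h := contDiff_normalMap G y
    exact (hG.isOpen.preimage h.continuous).inter
      (isOpen_isInvertible.preimage (h.continuous_fderiv (by simp)))
  mapsTo w hw := hw.1
  contDiffOn := (contDiff_normalMap G y).contDiffOn
  inv w hw := hw.2

/-- Conservation of energy for a perfect fluid whose energy density and pressure are constant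
along the flow: the expansion vanishes. -/
theorem trace_covDerivCoord_eq_zero {e : Module.Basis (Fin 4) ℝ E4} {η : Fin 4 → ℝ}
    (he : IsOrthonormalBasis (G y) e η)
    {U : E4 → E4} {q l : E4 → ℝ} (hU : DifferentiableAt ℝ U y)
    (hq : DifferentiableAt ℝ q y) (hl : DifferentiableAt ℝ l y)
    (hunit : ∀ᶠ x in 𝓝 y, G x (U x) (U x) = -1)
    (hric : ∀ᶠ x in 𝓝 y, ∀ v w, ricciCoord G x v w =
      q x * (G x (U x) v * G x (U x) w) + l x * G x v w)
    (hqU : fderiv ℝ q y (U y) = 0) (hlU : fderiv ℝ l y (U y) = 0) (hq0 : q y ≠ 0) :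
    LinearMap.trace ℝ E4 (covDerivCoord G U y).toLinearMap = 0 := by
  set Ψ := normalMap G y with hΨdef
  have hΨ := hG.isCoordChange_normalMap (y := y)
  rw [← hΨdef] at hΨ
  set s' := Ψ ⁻¹' s ∩ fderiv ℝ Ψ ⁻¹' {f | f.IsInvertible}
  have Ψ0 : Ψ 0 = y := by simp [hΨdef, normalMap]
  have D0 : fderiv ℝ Ψ 0 = ContinuousLinearMap.id ℝ E4 := by
    rw [hΨdef, hG.fderiv_normalMap hy]; simp
  have h0 : (0 : E4) ∈ s' := by
    refine ⟨by simpa [Ψ0] using hy, ?_⟩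
    change (fderiv ℝ Ψ 0).IsInvertible
    rw [D0]
    exact ⟨ContinuousLinearEquiv.refl ℝ E4, rfl⟩
  have hm := hΨ.isMetricOn_pullbackForm hG
  have G0 : pullbackForm Ψ G 0 = G y := by
    ext v w; rw [pullbackForm_apply, D0, Ψ0]; rfl
  -- At the origin `DΨ = id` and `D²Ψ = -Γ`, so the inhomogeneous term of the transformation law
  -- cancels `Γ`.
  have c0 : christoffel (pullbackForm Ψ G) 0 = 0 := by
    ext1 v; ext1 w
    have := hΨ.fderiv_christoffel_pullbackForm hG h0 v w
    rw [D0, Ψ0, hΨdef, hG.fderiv_fderiv_normalMap hy] at this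
    simpa using this
  set U' : E4 → E4 := fun w => (fderiv ℝ Ψ w).inverse (U (Ψ w)) with hU'def
  have hΨd : HasFDerivAt Ψ (ContinuousLinearMap.id ℝ E4) 0 := D0 ▸ hΨ.hasFDerivAt h0
  have hcomp : ∀ {f : E4 → ℝ}, DifferentiableAt ℝ f y →
      HasFDerivAt (fun w => f (Ψ w)) (fderiv ℝ f y) 0 := fun {f} hf =>
    HasFDerivAt.comp (g := f) (f := Ψ) (0 : E4) (by rw [Ψ0]; exact hf.hasFDerivAt) hΨd
  have hUΨ : DifferentiableAt ℝ (fun w => U (Ψ w)) 0 :=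
    DifferentiableAt.comp (g := U) (f := Ψ) (0 : E4) (by rw [Ψ0]; exact hU)
      hΨd.differentiableAt
  have hinv : DifferentiableAt ℝ (fun w => (fderiv ℝ Ψ w).inverse) 0 :=
    ((((hΨ.inv 0 h0).contDiffAt_map_inverse (n := ∞)).comp 0
      (hΨ.contDiffAt_fderiv h0)).differentiableAt (by simp))
  have hU' : DifferentiableAt ℝ U' 0 := hinv.clm_apply hUΨ
  have hrel : ∀ w ∈ s', fderiv ℝ Ψ w (U' w) = U (Ψ w) := fun w hw =>
    (hΨ.inv w hw).self_apply_inverse _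
  have U0 : U' 0 = U y := by
    have := hrel 0 h0
    rwa [D0, Ψ0] at this
  have tend : Filter.Tendsto Ψ (𝓝 0) (𝓝 y) := by
    have := hΨd.continuousAt
    rwa [ContinuousAt, Ψ0] at this
  have key := hm.trace_fderiv_eq_zero h0 c0 (e := e) (η := η) (by rw [G0]; exact he)
    (U := U') (q := fun w => q (Ψ w)) (l := fun w => l (Ψ w)) hU'
    (hcomp hq).differentiableAt (hcomp hl).differentiableAt
    (by
      filter_upwards [tend.eventually hunit, hm.eventually_mem h0] with w hw hws
      rw [pullbackForm_apply, hrel w hws, hw])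
    (by
      filter_upwards [tend.eventually hric, hm.eventually_mem h0] with w hw hws v z
      rw [hΨ.ricciCoord_pullbackForm hG hws, hw]
      simp only [pullbackForm_apply, hrel w hws])
    (by rw [(hcomp hq).fderiv, U0, hqU]) (by rw [(hcomp hl).fderiv, U0, hlU])
    (by simpa [Ψ0] using hq0)
  -- Since `DΨ = id` at the origin, the covariant derivative is the plain derivative of the
  -- transported field.
  have : covDerivCoord G U y = fderiv ℝ U' 0 := by
    ext1 v
    have h := hΨ.covDerivCoord_pullbackForm hG h0 (U := U) (U' := U') (by rwa [Ψ0]) hU'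
      (by filter_upwards [hm.eventually_mem h0] with w hw using hrel w hw) v
    rw [D0, Ψ0] at h
    have h' : covDerivCoord (pullbackForm Ψ G) U' 0 v = covDerivCoord G U y v := h
    rw [← h', covDerivCoord, c0]
    simp
  rw [this, key]

end IsMetricOn

/-! ### Passage from the manifold to its charts. -/

section

theorem contDiffAt_clm_of_apply {D F : Type*} [NormedAddCommGroup D] [NormedSpace ℝ D]
    [NormedAddCommGroup F] [NormedSpace ℝ F] {f : D → E4 →L[ℝ] F} {y : D}
    (h : ∀ v, ContDiffAt ℝ ∞ (fun z => f z v) y) : ContDiffAt ℝ ∞ f y := by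
  have e : f = fun z => ∑ i : Fin 4,
      ContinuousLinearMap.smulRightL ℝ E4 F (EuclideanSpace.proj i : E4 →L[ℝ] ℝ)
        (f z (EuclideanSpace.single i 1)) := by
    funext z
    ext1 v
    conv_lhs => rw [← (EuclideanSpace.basisFun (Fin 4) ℝ).sum_repr v]
    simp
  rw [e]
  exact ContDiffAt.sum fun i _ => ContDiffAt.comp y
    (ContinuousLinearMap.contDiff _).contDiffAt (h _)

theorem IsMetricOn.contDiffAt_ricciCoord {G : E4 → E4 →L[ℝ] E4 →L[ℝ] ℝ} {s : Set E4}
    (hG : IsMetricOn G s) {y : E4} (hy : y ∈ s) : ContDiffAt ℝ ∞ (ricciCoord G) y := by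
  refine contDiffAt_clm_of_apply fun v => contDiffAt_clm_of_apply fun w => ?_
  simp only [ricciCoord_apply]
  exact ContDiffAt.sum fun i _ =>
    (EuclideanSpace.proj i : E4 →L[ℝ] ℝ).contDiff.contDiffAt.comp y
      (hG.contDiffAt_riemannCoord hy _ v w)

theorem ricciCoord_congr {G G' : E4 → E4 →L[ℝ] E4 →L[ℝ] ℝ} {y : E4} (h : G =ᶠ[𝓝 y] G') :
    ricciCoord G y = ricciCoord G' y := by
  have h1 : fderiv ℝ G =ᶠ[𝓝 y] fderiv ℝ G' := h.fderiv
  have h2 : christoffel G =ᶠ[𝓝 y] christoffel G' := by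
    filter_upwards [h, h1] with z hz hz1
    simp only [christoffel, christoffelFirst, hz, hz1]
  ext v w
  simp only [ricciCoord_apply, riemannCoord, h2.self_of_nhds, h2.fderiv_eq]

variable {M : Type*} [TopologicalSpace M] [ChartedSpace E4 M] [IsManifold (𝓡 4) ∞ M]

instance isManifold_infty_add_one : IsManifold (𝓡 4) (∞ + 1) M := ‹IsManifold (𝓡 4) ∞ M›

/-- The derivative of the chart around `c`. -/
def chartD (c x : M) : TangentSpace (𝓡 4) x →L[ℝ] E4 :=
  mfderiv (𝓡 4) 𝓘(ℝ, E4) (extChartAt (𝓡 4) c) x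

/-- The derivative of the inverse of the chart around `c`. -/
def chartSymmD (c : M) (y : E4) : E4 →L[ℝ] TangentSpace (𝓡 4) ((extChartAt (𝓡 4) c).symm y) :=
  mfderiv 𝓘(ℝ, E4) (𝓡 4) (extChartAt (𝓡 4) c).symm y

theorem chartSymmD_eq (c : M) (y : E4) : chartSymmD c y =
    mfderivWithin 𝓘(ℝ, E4) (𝓡 4) (extChartAt (𝓡 4) c).symm (Set.range (𝓡 4)) y := by
  rw [chartSymmD, ModelWithCorners.range_eq_univ, mfderivWithin_univ]

theorem chartD_chartSymmD (c : M) {y : E4} (hy : y ∈ (extChartAt (𝓡 4) c).target) (v : E4) :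
    chartD c ((extChartAt (𝓡 4) c).symm y) (chartSymmD c y v) = v := by
  rw [chartSymmD_eq]
  exact congrArg (fun L : E4 →L[ℝ] E4 => L v)
    (mfderiv_extChartAt_comp_mfderivWithin_extChartAt_symm (I := 𝓡 4) hy)

theorem chartSymmD_chartD (c : M) {y : E4} (hy : y ∈ (extChartAt (𝓡 4) c).target)
    (v : TangentSpace (𝓡 4) ((extChartAt (𝓡 4) c).symm y)) :
    chartSymmD c y (chartD c ((extChartAt (𝓡 4) c).symm y) v) = v := by
  rw [chartSymmD_eq]
  exact congrArg (fun L : TangentSpace (𝓡 4) ((extChartAt (𝓡 4) c).symm y) →L[ℝ] _ => L v)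
    (mfderivWithin_extChartAt_symm_comp_mfderiv_extChartAt (I := 𝓡 4) hy)

theorem chartD_self (c : M) : chartD c c = ContinuousLinearMap.id ℝ E4 :=
  mfderiv_extChartAt_self

theorem isInvertible_chartD (c : M) {x : M} (hx : x ∈ (extChartAt (𝓡 4) c).source) :
    (chartD c x).IsInvertible := isInvertible_mfderiv_extChartAt hx

theorem contMDiffAt_of_extChartAt {F : Type*} [NormedAddCommGroup F] [NormedSpace ℝ F] {f : M → F}
    {f' : E4 → F} {c : M} (hf' : ContDiffAt ℝ ∞ f' (extChartAt (𝓡 4) c c))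
    (h : ∀ᶠ x in 𝓝 c, f x = f' (extChartAt (𝓡 4) c x)) :
    ContMDiffAt (𝓡 4) 𝓘(ℝ, F) ∞ f c := by
  have : ContMDiffAt (𝓡 4) 𝓘(ℝ, F) ∞ (f' ∘ extChartAt (𝓡 4) c) c :=
    hf'.contMDiffAt.comp c contMDiffAt_extChartAt
  exact this.congr_of_eventuallyEq h

theorem contDiffAt_comp_extChartAt_symm {F : Type*} [NormedAddCommGroup F] [NormedSpace ℝ F]
    {f : M → F} {c : M} {y : E4} (hy : y ∈ (extChartAt (𝓡 4) c).target)
    (hf : ContMDiffAt (𝓡 4) 𝓘(ℝ, F) ∞ f ((extChartAt (𝓡 4) c).symm y)) :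
    ContDiffAt ℝ ∞ (fun z => f ((extChartAt (𝓡 4) c).symm z)) y := by
  have h : ContMDiffAt 𝓘(ℝ, E4) (𝓡 4) ∞ (extChartAt (𝓡 4) c).symm y :=
    (contMDiffOn_extChartAt_symm c).contMDiffAt
      ((isOpen_extChartAt_target c).mem_nhds hy)
  exact (ContMDiffAt.comp y hf h).contDiffAt

theorem eventually_mem_source (c : M) : ∀ᶠ x in 𝓝 c, x ∈ (extChartAt (𝓡 4) c).source :=
  extChartAt_source_mem_nhds c

/-- Smoothness of sections of the tangent bundle becomes smoothness of components in a chart. -/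
theorem trivializationAt_eq_chartD (c : M) {x : M} (hx : x ∈ (extChartAt (𝓡 4) c).source)
    (v : TangentSpace (𝓡 4) x) :
    (trivializationAt E4 (TangentSpace (𝓡 4)) c ⟨x, v⟩).2 = chartD c x v := by
  rw [extChartAt_source] at hx
  rw [chartD, ← TangentBundle.continuousLinearMapAt_trivializationAt hx]
  exact (congrFun (Bundle.Trivialization.coe_linearMapAt_of_mem _ (by simpa using hx)) v).symm

theorem smoothVectorField_of_chartD {u : ∀ x : M, TangentSpace (𝓡 4) x}
    (h : ∀ c : M, ∃ U : E4 → E4, ContDiffAt ℝ ∞ U (extChartAt (𝓡 4) c c) ∧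
      ∀ᶠ x in 𝓝 c, chartD c x (u x) = U (extChartAt (𝓡 4) c x)) : SmoothVectorField u := by
  intro c
  obtain ⟨U, hU, hu⟩ := h c
  rw [Bundle.contMDiffAt_section]
  refine contMDiffAt_of_extChartAt hU ?_
  filter_upwards [hu, eventually_mem_source c] with x hx hxs
  rw [trivializationAt_eq_chartD c hxs, hx]

/-- The components of a vector field in the chart around `c`. -/
def components (c : M) (u : ∀ x : M, TangentSpace (𝓡 4) x) (y : E4) : E4 :=
  chartD c ((extChartAt (𝓡 4) c).symm y) (u ((extChartAt (𝓡 4) c).symm y))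

theorem contDiffAt_components (c : M) {u : ∀ x : M, TangentSpace (𝓡 4) x}
    (hu : SmoothVectorField u) : ContDiffAt ℝ ∞ (components c u) (extChartAt (𝓡 4) c c) := by
  have h := (Bundle.contMDiffAt_section c).1 (hu c)
  have h2 : ContMDiffAt (𝓡 4) 𝓘(ℝ, E4) ∞ (fun x => chartD c x (u x)) c := by
    refine h.congr_of_eventuallyEq ?_
    filter_upwards [eventually_mem_source c] with x hxs
    rw [trivializationAt_eq_chartD c hxs]
  exact contDiffAt_comp_extChartAt_symm (mem_extChartAt_target c)
    (by rw [extChartAt_to_inv]; exact h2)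

theorem components_extChartAt (c : M) (u : ∀ x : M, TangentSpace (𝓡 4) x) {x : M}
    (hx : x ∈ (extChartAt (𝓡 4) c).source) :
    components c u (extChartAt (𝓡 4) c x) = chartD c x (u x) := by
  rw [components, (extChartAt (𝓡 4) c).left_inv hx]

namespace LorentzMetric

variable (g : LorentzMetric M)

theorem val_injective (x : M) : Function.Injective (g.val x) := by
  obtain ⟨b, hb⟩ := g.signature x
  have : IsOrthonormalBasis (g.val x) b (fun i => if i = 0 then -1 else 1) :=
    ⟨fun i => by split_ifs <;> norm_num, hb⟩
  exact this.injective

theorem contMDiffOn_val_chartSymmD (c : M) (v w : E4) :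
    ContMDiffOn (𝓡 4) 𝓘(ℝ, ℝ) ∞ (fun x => g.val x
      ((trivializationAt E4 (TangentSpace (𝓡 4)) c).symm x v)
      ((trivializationAt E4 (TangentSpace (𝓡 4)) c).symm x w))
      (extChartAt (𝓡 4) c).source := by
  set e := trivializationAt E4 (TangentSpace (𝓡 4) (M := M)) c
  have hs : (extChartAt (𝓡 4) c).source = e.baseSet := by
    rw [extChartAt_source]; rfl
  rw [hs]
  have sec : ∀ v : E4, ContMDiffOn (𝓡 4) (𝓡 4).tangent ∞
      (fun x => Bundle.TotalSpace.mk' E4 x (e.symm x v)) e.baseSet := by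
    intro v
    have h1 := e.contMDiffOn_symm (IB := 𝓡 4) (n := ∞)
    have h2 : ContMDiffOn (𝓡 4) ((𝓡 4).prod 𝓘(ℝ, E4)) ∞ (fun x : M => (x, v)) e.baseSet :=
      (contMDiff_id.prodMk contMDiff_const).contMDiffOn
    refine (h1.comp h2 fun x hx => ?_).congr fun x hx => ?_
    · exact e.mem_target.2 hx
    · exact e.mk_symm hx v
  intro x hx
  have : ContMDiffWithinAt (𝓡 4) ((𝓡 4).prod 𝓘(ℝ)) ∞
      (fun m ↦ Bundle.TotalSpace.mk' ℝ (E := Bundle.Trivial M ℝ) m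
        (g.val m (e.symm m v) (e.symm m w))) e.baseSet x := by
    apply ContMDiffWithinAt.clm_bundle_apply₂ (F₁ := E4) (F₂ := E4)
    · exact (g.smooth x).contMDiffWithinAt
    · exact sec v x hx
    · exact sec w x hx
  simp only [Bundle.contMDiffWithinAt_totalSpace] at this
  exact this.2

theorem inChart_eq (c : M) (y v w : E4) : g.inChart c y v w =
    g.val ((extChartAt (𝓡 4) c).symm y) (chartSymmD c y v) (chartSymmD c y w) := rfl

theorem chartSymmD_eq_symm (c : M) {y : E4} (hy : y ∈ (extChartAt (𝓡 4) c).target) (v : E4) :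
    chartSymmD c y v = (trivializationAt E4 (TangentSpace (𝓡 4)) c).symm
      ((extChartAt (𝓡 4) c).symm y) v := by
  have hx : (extChartAt (𝓡 4) c).symm y ∈ (chartAt E4 c).source := by
    rw [← extChartAt_source (𝓡 4)]; exact (extChartAt (𝓡 4) c).map_target hy
  have := TangentBundle.symmL_trivializationAt (I := 𝓡 4) (𝕜 := ℝ) hx
  rw [(extChartAt (𝓡 4) c).right_inv hy] at this
  rw [chartSymmD_eq, ← this]
  exact Bundle.Trivialization.symmL_apply _ (by simpa using hx) _

theorem isMetricOn_inChart (c : M) : IsMetricOn (g.inChart c) (extChartAt (𝓡 4) c).target where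
  isOpen := isOpen_extChartAt_target c
  contDiffOn := by
    intro y hy
    refine (contDiffAt_clm_of_apply fun v => contDiffAt_clm_of_apply fun w =>
      ?_).contDiffWithinAt
    have hx := (extChartAt (𝓡 4) c).map_target hy
    have h := contDiffAt_comp_extChartAt_symm hy ((g.contMDiffOn_val_chartSymmD c v w).contMDiffAt
      ((isOpen_extChartAt_source c).mem_nhds hx))
    refine h.congr_of_eventuallyEq ?_
    filter_upwards [(isOpen_extChartAt_target c).mem_nhds hy] with z hz
    rw [inChart_eq, chartSymmD_eq_symm c hz, chartSymmD_eq_symm c hz]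
  symm y _ v w := g.symm _ _ _
  inv y hy := by
    refine isInvertible_of_injective finrank_dual_E4 fun v w h => ?_
    have h2 : chartSymmD c y v = chartSymmD c y w := by
      apply g.val_injective
      ext z
      have := congrArg (fun L : E4 →L[ℝ] ℝ =>
        L (chartD c ((extChartAt (𝓡 4) c).symm y) z)) h
      simpa only [inChart_eq, chartSymmD_chartD c hy] using this
    rw [← chartD_chartSymmD c hy v, h2, chartD_chartSymmD c hy]

theorem fderiv_coordChange (c c' : M) {y : E4}
    (hy : y ∈ ((extChartAt (𝓡 4) c').symm.trans (extChartAt (𝓡 4) c)).source) (v : E4) :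
    fderiv ℝ (extChartAt (𝓡 4) c ∘ (extChartAt (𝓡 4) c').symm) y v =
      chartD c ((extChartAt (𝓡 4) c').symm y) (chartSymmD c' y v) := by
  rw [PartialEquiv.trans_source, PartialEquiv.symm_source] at hy
  have h1 : MDifferentiableAt 𝓘(ℝ, E4) (𝓡 4) (extChartAt (𝓡 4) c').symm y :=
    (mdifferentiableOn_extChartAt_symm.mdifferentiableAt
      ((isOpen_extChartAt_target c').mem_nhds hy.1))
  have h2 : MDifferentiableAt (𝓡 4) 𝓘(ℝ, E4) (extChartAt (𝓡 4) c)
      ((extChartAt (𝓡 4) c').symm y) :=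
    mdifferentiableAt_extChartAt (by simpa using hy.2)
  rw [← mfderiv_eq_fderiv, mfderiv_comp y h2 h1]
  rfl

theorem val_eq_inChart (c : M) {x : M} (hx : x ∈ (extChartAt (𝓡 4) c).source)
    (v w : TangentSpace (𝓡 4) x) : g.val x v w =
      g.inChart c (extChartAt (𝓡 4) c x) (chartD c x v) (chartD c x w) := by
  obtain ⟨y, hy, rfl⟩ : ∃ y ∈ (extChartAt (𝓡 4) c).target, (extChartAt (𝓡 4) c).symm y = x :=
    ⟨_, (extChartAt (𝓡 4) c).map_source hx, (extChartAt (𝓡 4) c).left_inv hx⟩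
  rw [(extChartAt (𝓡 4) c).right_inv hy, inChart_eq, chartSymmD_chartD c hy,
    chartSymmD_chartD c hy]

/-- The change of coordinates from the chart around `c'` to the chart around `c`. -/
theorem isCoordChange (c c' : M) :
    IsCoordChange (extChartAt (𝓡 4) c ∘ (extChartAt (𝓡 4) c').symm)
      ((extChartAt (𝓡 4) c').symm.trans (extChartAt (𝓡 4) c)).source
      (extChartAt (𝓡 4) c).target where
  isOpen := by
    rw [PartialEquiv.trans_source, PartialEquiv.symm_source]
    exact (continuousOn_extChartAt_symm c').isOpen_inter_preimage (isOpen_extChartAt_target c')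
      (isOpen_extChartAt_source c)
  mapsTo y hy := by
    rw [PartialEquiv.trans_source] at hy
    exact (extChartAt (𝓡 4) c).map_source hy.2
  contDiffOn := contDiffOn_ext_coord_change c c'
  inv y hy := by
    refine isInvertible_of_injective rfl fun v w h => ?_
    rw [fderiv_coordChange c c' hy, fderiv_coordChange c c' hy] at h
    rw [PartialEquiv.trans_source, PartialEquiv.symm_source] at hy
    have := (isInvertible_chartD c hy.2).injective h
    rw [← chartD_chartSymmD c' hy.1 v, this, chartD_chartSymmD c' hy.1]

theorem inChart_eq_pullbackForm (c c' : M) {y : E4}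
    (hy : y ∈ ((extChartAt (𝓡 4) c').symm.trans (extChartAt (𝓡 4) c)).source) :
    g.inChart c' y =
      pullbackForm (extChartAt (𝓡 4) c ∘ (extChartAt (𝓡 4) c').symm) (g.inChart c) y := by
  ext v w
  rw [pullbackForm_apply, fderiv_coordChange c c' hy, fderiv_coordChange c c' hy]
  rw [PartialEquiv.trans_source, PartialEquiv.symm_source] at hy
  exact g.val_eq_inChart c hy.2 _ _

/-- The Ricci tensor at `x` has the components given by any chart. -/
theorem ricci_eq_ricciCoord (c : M) {x : M} (hx : x ∈ (extChartAt (𝓡 4) c).source)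
    (v w : TangentSpace (𝓡 4) x) : g.ricci x v w =
      ricciCoord (g.inChart c) (extChartAt (𝓡 4) c x) (chartD c x v) (chartD c x w) := by
  have h0 := extChartAt_to_inv (I := 𝓡 4) x
  have hy : extChartAt (𝓡 4) x x ∈
      ((extChartAt (𝓡 4) x).symm.trans (extChartAt (𝓡 4) c)).source := by
    rw [PartialEquiv.trans_source, PartialEquiv.symm_source]
    exact ⟨mem_extChartAt_target x, by rwa [Set.mem_preimage, h0]⟩
  have hΨ := isCoordChange c x
  -- In its own chart the tangent space at `x` is `ℝ⁴` itself: the inverse chart has derivative the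
  -- identity there.
  have hD : ∀ v : E4, fderiv ℝ (extChartAt (𝓡 4) c ∘ (extChartAt (𝓡 4) x).symm)
      (extChartAt (𝓡 4) x x) v = chartD c x v := by
    intro v
    rw [fderiv_coordChange c x hy]
    have h1 : chartSymmD x (extChartAt (𝓡 4) x x) v = v := by
      rw [chartSymmD_eq]
      exact congrArg (fun L : E4 →L[ℝ] E4 => L v) mfderivWithin_range_extChartAt_symm
    rw [h1]
    exact congrArg (fun z => (chartD c z : E4 →L[ℝ] E4) v) h0
  have hE : g.inChart x =ᶠ[𝓝 (extChartAt (𝓡 4) x x)]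
      pullbackForm (extChartAt (𝓡 4) c ∘ (extChartAt (𝓡 4) x).symm) (g.inChart c) := by
    filter_upwards [hΨ.isOpen.mem_nhds hy] with y hy using g.inChart_eq_pullbackForm c x hy
  have key : ∀ v w : E4, ricciCoord (g.inChart x) (extChartAt (𝓡 4) x x) v w =
      ricciCoord (g.inChart c) (extChartAt (𝓡 4) c x) (chartD c x v) (chartD c x w) := by
    intro v w
    rw [ricciCoord_congr hE, hΨ.ricciCoord_pullbackForm (g.isMetricOn_inChart c) hy, hD, hD,
      Function.comp_apply, h0]
  exact key v w

end LorentzMetric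

end

section

/-! ### Algebra of symmetric tensors -/

theorem cbrt_cube (a : ℝ) : cbrt (a ^ 3) = a := by
  unfold cbrt
  rcases le_or_gt 0 a with h | h
  · rw [if_pos (by positivity), ← Real.rpow_natCast, ← Real.rpow_mul h]
    norm_num
  · have h1 : a ^ 3 < 0 := Odd.pow_neg (by decide) h
    rw [if_neg (not_le.2 h1), show -a ^ 3 = (-a) ^ 3 by ring, ← Real.rpow_natCast,
      ← Real.rpow_mul (by linarith)]
    norm_num

theorem cbrt_neg_of_neg {a : ℝ} (h : a < 0) : cbrt a = -((-a) ^ (1 / 3 : ℝ)) := by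
  rw [cbrt, if_neg (not_le.2 h)]

/-- Negative arguments are the relevant ones: `q > 0` means `tr N³ < 0`. -/
theorem contDiffAt_cbrt {a : ℝ} (h : a < 0) : ContDiffAt ℝ ∞ cbrt a := by
  have h1 : ContDiffAt ℝ ∞ (fun a : ℝ => -((-a) ^ (1 / 3 : ℝ))) a :=
    (contDiffAt_id.neg.rpow_const_of_ne (by simpa using h.ne)).neg
  refine h1.congr_of_eventuallyEq ?_
  filter_upwards [Iio_mem_nhds h] with b hb using cbrt_neg_of_neg hb

section Algebra

variable {V : Type*} [AddCommGroup V] [Module ℝ V] [TopologicalSpace V]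
  {B : V →L[ℝ] V →L[ℝ] ℝ} {e : Module.Basis (Fin 4) ℝ V} {η : Fin 4 → ℝ}

/-- The trace of `a u ⊗ B u + b id` and of its cube, for a unit time-like vector `u`. -/
theorem IsOrthonormalBasis.trace_fluid (he : IsOrthonormalBasis B e η) {u : V}
    (hu : B u u = -1) {a b : ℝ} {L : V →ₗ[ℝ] V} (hL : ∀ v, L v = (a * B u v) • u + b • v) :
    LinearMap.trace ℝ V L = -a + 4 * b ∧
      LinearMap.trace ℝ V (L ^ 3) = -a ^ 3 + 3 * a ^ 2 * b - 3 * a * b ^ 2 + 4 * b ^ 3 := by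
  have key : ∀ {a b : ℝ} {L : V →ₗ[ℝ] V}, (∀ v, L v = (a * B u v) • u + b • v) →
      LinearMap.trace ℝ V L = -a + 4 * b := by
    intro a b L hL
    rw [he.trace_eq]
    have : ∀ i, η i * B (L (e i)) (e i) = a * (η i * (B u (e i) * B u (e i))) + b := by
      intro i
      have h1 : B (e i) (e i) = η i := by simp [he.apply]
      have h2 := he.sq i
      simp only [hL, map_add, map_smul, add_apply, smul_apply, smul_eq_mul, h1]
      linear_combination b * h2
    simp only [this]
    rw [Finset.sum_add_distrib, ← Finset.mul_sum, he.sum_mul, hu]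
    simp
  refine ⟨key hL, ?_⟩
  -- `L` is `b - a` on `u` and `b` on its orthogonal complement; the cube has the same form, with
  -- `b³` for `b` and `b³ - (b - a)³` for `a`.
  have h3 : ∀ v, (L ^ 3) v = ((a ^ 3 - 3 * a ^ 2 * b + 3 * a * b ^ 2) * B u v) • u
      + (b ^ 3) • v := by
    intro v
    simp only [pow_succ, pow_zero, one_mul, Module.End.mul_apply, hL, map_add, map_smul,
      smul_eq_mul, hu]
    module
  rw [key h3]
  ring

/-- A symmetric tensor `S` with `S² + q S = 0` and trace `-q ≠ 0` has rank one. -/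
theorem IsOrthonormalBasis.rank_one (he : IsOrthonormalBasis B e η)
    {S : V →L[ℝ] V →L[ℝ] ℝ} (hS : ∀ v w, S v w = S w v) {q : ℝ} (hq : q ≠ 0)
    {L : V →ₗ[ℝ] V} (hL : ∀ v, B (L v) = S v) (hsq : ∀ v, S (L v) + q • S v = 0)
    (htr : LinearMap.trace ℝ V L = -q) (x v w : V) : S x x * S v w = S x v * S x w := by
  have : FiniteDimensional ℝ V := e.finiteDimensional_of_finite
  have hLL : ∀ v, L (L v) = -q • L v := by
    intro v
    apply he.injective
    rw [hL, map_smul, hL, neg_smul]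
    exact eq_neg_of_add_eq_zero_left (hsq v)
  -- The rank of a projector is its trace, here `1`: the range of `L` is a line, spanned by `f`.
  have hid : IsIdempotentElem ((-q⁻¹) • L) := by
    apply LinearMap.ext
    intro v
    simp only [Module.End.mul_apply, LinearMap.smul_apply, map_smul, hLL, smul_smul]
    congr 1
    field_simp
  have ht := (LinearMap.IsIdempotentElem.isProj_range _ hid).trace
  rw [map_smul, htr, smul_eq_mul, neg_mul_neg, inv_mul_cancel₀ hq] at ht
  have ht1 : Module.finrank ℝ (LinearMap.range ((-q⁻¹) • L)) = 1 := by exact_mod_cast ht.symm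
  obtain ⟨⟨f, _⟩, -, hf⟩ := finrank_eq_one_iff'.1 ht1
  have hc : ∀ v, ∃ c : ℝ, L v = c • f := by
    intro v
    obtain ⟨c, hc⟩ := hf ⟨((-q⁻¹) • L) v, LinearMap.mem_range_self _ v⟩
    have h1 : c • f = (-q⁻¹) • L v := congrArg Subtype.val hc
    refine ⟨-q * c, ?_⟩
    rw [mul_smul, h1, smul_smul]
    simp [hq]
  choose c hc using hc
  have hSc : ∀ v w, S v w = c v * B f w := by
    intro v w
    rw [← hL, hc]
    simp
  calc S x x * S v w = S x x * (c v * B f w) := by rw [hSc v w]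
    _ = (c v * B f x) * (c x * B f w) := by rw [hSc x x]; ring
    _ = S x v * S x w := by rw [← hSc, ← hSc, hS v x]

end Algebra

/-! ### Smooth tensor fields of type `(0,2)` -/

variable {M : Type*} [TopologicalSpace M] [ChartedSpace E4 M] [IsManifold (𝓡 4) ∞ M]

/-- The tensor field `S` has smooth components at the centre of every chart. -/
def SmoothTensor (S : ∀ x : M, TangentSpace (𝓡 4) x →L[ℝ] TangentSpace (𝓡 4) x →L[ℝ] ℝ) : Prop :=
  ∀ c : M, ∃ S' : E4 → E4 →L[ℝ] E4 →L[ℝ] ℝ, ContDiffAt ℝ ∞ S' (extChartAt (𝓡 4) c c) ∧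
    ∀ᶠ x in 𝓝 c, ∀ v w : TangentSpace (𝓡 4) x,
      S x v w = S' (extChartAt (𝓡 4) c x) (chartD c x v) (chartD c x w)

theorem contDiffAt_symm_of_contMDiff {f : M → ℝ} (hf : ContMDiff (𝓡 4) 𝓘(ℝ, ℝ) ∞ f) (c : M) :
    ContDiffAt ℝ ∞ (fun y => f ((extChartAt (𝓡 4) c).symm y)) (extChartAt (𝓡 4) c c) :=
  contDiffAt_comp_extChartAt_symm (mem_extChartAt_target c) (hf _)

namespace SmoothTensor

variable {S T : ∀ x : M, TangentSpace (𝓡 4) x →L[ℝ] TangentSpace (𝓡 4) x →L[ℝ] ℝ}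

theorem sub (hS : SmoothTensor S) (hT : SmoothTensor T) : SmoothTensor fun x => S x - T x := by
  intro c
  obtain ⟨S', hS', h⟩ := hS c
  obtain ⟨T', hT', k⟩ := hT c
  refine ⟨fun y => S' y - T' y, hS'.sub hT', ?_⟩
  filter_upwards [h, k] with x hx kx v w
  simp only [sub_apply, hx, kx]

theorem smul (hS : SmoothTensor S) {f : M → ℝ} (hf : ContMDiff (𝓡 4) 𝓘(ℝ, ℝ) ∞ f) :
    SmoothTensor fun x => f x • S x := by
  intro c
  obtain ⟨S', hS', h⟩ := hS c
  refine ⟨fun y => f ((extChartAt (𝓡 4) c).symm y) • S' y,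
    (contDiffAt_symm_of_contMDiff hf c).smul hS', ?_⟩
  filter_upwards [h, eventually_mem_source c] with x hx hxs v w
  simp only [smul_apply, hx, (extChartAt (𝓡 4) c).left_inv hxs]

theorem apply (hS : SmoothTensor S) {u v : ∀ x : M, TangentSpace (𝓡 4) x}
    (hu : SmoothVectorField u) (hv : SmoothVectorField v) :
    ContMDiff (𝓡 4) 𝓘(ℝ, ℝ) ∞ fun x => S x (u x) (v x) := by
  intro c
  obtain ⟨S', hS', h⟩ := hS c
  refine contMDiffAt_of_extChartAt (f' := fun y => S' y (components c u y) (components c v y))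
    ((hS'.clm_apply (contDiffAt_components c hu)).clm_apply (contDiffAt_components c hv)) ?_
  filter_upwards [h, eventually_mem_source c] with x hx hxs
  rw [hx, components_extChartAt c u hxs, components_extChartAt c v hxs]

end SmoothTensor

theorem SmoothVectorField.smul {u : ∀ x : M, TangentSpace (𝓡 4) x} (hu : SmoothVectorField u)
    {f : M → ℝ} (hf : ContMDiff (𝓡 4) 𝓘(ℝ, ℝ) ∞ f) : SmoothVectorField fun x => f x • u x := by
  refine smoothVectorField_of_chartD fun c => ⟨fun y => f ((extChartAt (𝓡 4) c).symm y) •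
    components c u y, (contDiffAt_symm_of_contMDiff hf c).smul (contDiffAt_components c hu), ?_⟩
  filter_upwards [eventually_mem_source c] with x hxs
  rw [map_smul, (extChartAt (𝓡 4) c).left_inv hxs, components_extChartAt c u hxs]

namespace LorentzMetric

variable (g : LorentzMetric M)

theorem isInvertible_val (x : M) : (g.val x).IsInvertible :=
  isInvertible_of_injective (V := E4) (W := E4 →L[ℝ] ℝ) finrank_dual_E4 (g.val_injective x)

theorem val_mixed (x : M) (S : TangentSpace (𝓡 4) x →L[ℝ] TangentSpace (𝓡 4) x →L[ℝ] ℝ)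
    (v : TangentSpace (𝓡 4) x) : g.val x (g.mixed x S v) = S v :=
  (g.isInvertible_val x).self_apply_inverse _

theorem val_sharp (x : M) (ℓ : TangentSpace (𝓡 4) x →L[ℝ] ℝ) : g.val x (g.sharp x ℓ) = ℓ :=
  (g.isInvertible_val x).self_apply_inverse _

theorem exists_isOrthonormalBasis (x : M) :
    ∃ e η, IsOrthonormalBasis (g.val x) e η := by
  obtain ⟨b, hb⟩ := g.signature x
  exact ⟨b, fun i => if i = 0 then -1 else 1, fun i => by split_ifs <;> norm_num, hb⟩

theorem exists_isOrthonormalBasis_inChart (x : M) :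
    ∃ e η, IsOrthonormalBasis (V := E4) (g.inChart x (extChartAt (𝓡 4) x x)) e η := by
  obtain ⟨e, η, he⟩ := g.exists_isOrthonormalBasis x
  have hG : ∀ v w : E4, g.inChart x (extChartAt (𝓡 4) x x) v w =
      (g.val x : E4 →L[ℝ] E4 →L[ℝ] ℝ) v w := fun v w => by
    have := g.val_eq_inChart x (mem_extChartAt_source x) v w
    rw [chartD_self] at this
    exact this.symm
  have he' : IsOrthonormalBasis (V := E4) (g.inChart x (extChartAt (𝓡 4) x x)) e η :=
    ⟨he.sq, fun i j => (hG _ _).trans (he.apply i j)⟩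
  exact ⟨e, η, he'⟩

/-- The mixed components of a tensor in the chart around `c`. -/
theorem chartD_mixed (c : M) {x : M} (hx : x ∈ (extChartAt (𝓡 4) c).source)
    {S : TangentSpace (𝓡 4) x →L[ℝ] TangentSpace (𝓡 4) x →L[ℝ] ℝ} {S' : E4 →L[ℝ] E4 →L[ℝ] ℝ}
    (h : ∀ v w, S v w = S' (chartD c x v) (chartD c x w)) (v : TangentSpace (𝓡 4) x) :
    chartD c x (g.mixed x S v) =
      (g.inChart c (extChartAt (𝓡 4) c x)).inverse (S' (chartD c x v)) := by
  have hy := (extChartAt (𝓡 4) c).map_source hx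
  have hm := g.isMetricOn_inChart c
  apply hm.ext_apply hy
  intro z
  obtain ⟨z, rfl⟩ := (isInvertible_chartD c hx).surjective z
  rw [hm.apply_inverse hy, ← g.val_eq_inChart c hx, val_mixed, h]

theorem smoothTensor_val : SmoothTensor g.val := fun c =>
  ⟨g.inChart c, (g.isMetricOn_inChart c).contDiffAt (mem_extChartAt_target c), by
    filter_upwards [eventually_mem_source c] with x hx v w using g.val_eq_inChart c hx v w⟩

theorem smoothTensor_ricci : SmoothTensor g.ricci := fun c =>
  ⟨ricciCoord (g.inChart c), (g.isMetricOn_inChart c).contDiffAt_ricciCoord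
    (mem_extChartAt_target c), by
    filter_upwards [eventually_mem_source c] with x hx v w using g.ricci_eq_ricciCoord c hx v w⟩

theorem smoothVectorField_mixed
    {S : ∀ x : M, TangentSpace (𝓡 4) x →L[ℝ] TangentSpace (𝓡 4) x →L[ℝ] ℝ}
    (hS : SmoothTensor S) {u : ∀ x : M, TangentSpace (𝓡 4) x} (hu : SmoothVectorField u) :
    SmoothVectorField fun x => g.mixed x (S x) (u x) := by
  refine smoothVectorField_of_chartD fun c => ?_
  obtain ⟨S', hS', h⟩ := hS c
  refine ⟨fun y => (g.inChart c y).inverse (S' y (components c u y)),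
    ((g.isMetricOn_inChart c).contDiffAt_inverse (mem_extChartAt_target c)).clm_apply
      (hS'.clm_apply (contDiffAt_components c hu)), ?_⟩
  filter_upwards [h, eventually_mem_source c] with x hx hxs
  rw [g.chartD_mixed c hxs hx, components_extChartAt c u hxs]

/-- The chart derivative conjugates the mixed tensor to its smooth coordinate expression, and traces
are invariant. The exponents `1` and `3` serve `t` and `q`. -/
theorem contMDiff_trace_mixed_pow
    {S : ∀ x : M, TangentSpace (𝓡 4) x →L[ℝ] TangentSpace (𝓡 4) x →L[ℝ] ℝ}
    (hS : SmoothTensor S) (n : ℕ) : ContMDiff (𝓡 4) 𝓘(ℝ, ℝ) ∞ fun x =>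
      LinearMap.trace ℝ (TangentSpace (𝓡 4) x) ((g.mixed x (S x)).toLinearMap ^ n) := by
  intro c
  obtain ⟨S', hS', h⟩ := hS c
  have hL : ContDiffAt ℝ ∞ (fun y => (g.inChart c y).inverse.comp (S' y))
      (extChartAt (𝓡 4) c c) :=
    ((g.isMetricOn_inChart c).contDiffAt_inverse (mem_extChartAt_target c)).clm_comp hS'
  have hP : ContDiffAt ℝ ∞ (fun y => LinearMap.trace ℝ E4
      (((g.inChart c y).inverse.comp (S' y)).toLinearMap ^ n)) (extChartAt (𝓡 4) c c) := by
    have e : ∀ L : E4 →L[ℝ] E4, LinearMap.trace ℝ E4 (L.toLinearMap ^ n) =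
        ∑ i : Fin 4, ((L ^ n) (EuclideanSpace.single i 1)) i := fun L => by
      rw [trace_eq_sum_single, ← ContinuousLinearMap.toLinearMap_pow]; rfl
    simp only [e]
    exact ContDiffAt.sum fun i _ => (EuclideanSpace.proj i : E4 →L[ℝ] ℝ).contDiff.contDiffAt.comp _
      ((hL.pow n).clm_apply contDiffAt_const)
  refine contMDiffAt_of_extChartAt hP ?_
  filter_upwards [h, eventually_mem_source c] with x hx hxs
  obtain ⟨A, hA⟩ := isInvertible_chartD c hxs
  have hA' : ∀ v, A v = chartD c x v := fun v => by rw [← hA]; rfl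
  have hpow : ∀ (n : ℕ) (v : TangentSpace (𝓡 4) x), A (((g.mixed x (S x)).toLinearMap ^ n) v) =
      (((g.inChart c (extChartAt (𝓡 4) c x)).inverse.comp
        (S' (extChartAt (𝓡 4) c x))).toLinearMap ^ n) (A v) := by
    intro n
    induction n with
    | zero => intro v; simp
    | succ n ih =>
      intro v
      rw [pow_succ, pow_succ, Module.End.mul_apply, Module.End.mul_apply, ih]
      congr 1
      rw [hA', hA']
      exact g.chartD_mixed c hxs hx v
  exact trace_eq_of_intertwine A.toLinearEquiv (hpow n)

end LorentzMetric

end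

/-! ### Thermodynamics of the adiabatic evolution. -/

theorem hasFDerivAt_one_div {r : ℝ × ℝ → ℝ} {r' : ℝ × ℝ →L[ℝ] ℝ} {z : ℝ × ℝ}
    (h : HasFDerivAt r r' z) (h0 : r z ≠ 0) :
    HasFDerivAt (fun z' => 1 / r z') (-(1 / r z ^ 2) • r') z := by
  have := (hasDerivAt_inv h0).comp_hasFDerivAt z h
  simpa [Function.comp_def] using this

namespace Thermodynamics

section Adiabatic

variable (T : Thermodynamics) {z : ℝ × ℝ} (hz : z ∈ T.D)
include hz

theorem hasFDerivAt_r : HasFDerivAt T.r (fderiv ℝ T.r z) z :=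
  ((T.smooth_r.contDiffAt (T.isOpen_D.mem_nhds hz)).differentiableAt (by simp)).hasFDerivAt

theorem hasFDerivAt_ε : HasFDerivAt T.ε (fderiv ℝ T.ε z) z :=
  ((T.smooth_ε.contDiffAt (T.isOpen_D.mem_nhds hz)).differentiableAt (by simp)).hasFDerivAt

theorem hasFDerivAt_ρ : HasFDerivAt T.ρ (fderiv ℝ T.ρ z) z := by
  have h : HasFDerivAt T.ρ _ z := (T.hasFDerivAt_r hz).mul ((T.hasFDerivAt_ε hz).const_add 1)
  exact h.differentiableAt.hasFDerivAt

/-- The derivatives of `ρ` and `τ` with respect to the pressure: with the specific enthalpy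
eliminated, `r² τ'_p = 1 - ρ'_p`. -/
theorem deriv_τ_eq :
    deriv (fun p => T.τ (z.1, p)) z.2 = (1 - fderiv ℝ T.ρ z (0, 1)) / T.r z ^ 2 := by
  have hr0 : T.r z ≠ 0 := (T.r_pos z hz).ne'
  have hv : HasFDerivAt (fun z' => 1 / T.r z') _ z :=
    hasFDerivAt_one_div (T.hasFDerivAt_r hz) hr0
  have hb := congrArg (fun L : ℝ × ℝ →L[ℝ] ℝ => L (0, 1)) (T.balance z hz)
  rw [hv.fderiv] at hb
  have hρ : HasFDerivAt T.ρ _ z := (T.hasFDerivAt_r hz).mul ((T.hasFDerivAt_ε hz).const_add 1)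
  have hp : HasDerivAt (fun p : ℝ => (z.1, p)) (0, 1) z.2 :=
    (hasDerivAt_const z.2 z.1).prodMk (hasDerivAt_id z.2)
  have hτ : HasFDerivAt T.τ _ z :=
    (((T.hasFDerivAt_ε hz).add ((hasFDerivAt_snd (𝕜 := ℝ) (p := z)).mul hv)).const_add 1).mul hv
  have hc : HasDerivAt (fun p => T.τ (z.1, p)) _ z.2 :=
    HasFDerivAt.comp_hasDerivAt (f := fun p : ℝ => (z.1, p)) z.2 hτ hp
  rw [hc.deriv, hρ.fderiv]
  simp at hb ⊢
  -- At constant entropy the heat term of the balance drops out: `ε'_p = -p v'_p`.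
  have hε : fderiv ℝ T.ε z (0, 1) = z.2 * (fderiv ℝ T.r z (0, 1) / T.r z ^ 2) := by
    field_simp at hb ⊢
    linarith
  rw [hε, show T.v z = 1 / T.r z from rfl]
  field_simp
  ring

/-- The speed of sound, of square `1 / ρ'_p`, is less than that of light. What matters below is that
`ρ'_p` is not zero. -/
theorem one_lt_fderiv_ρ (h : T.H₁) : 1 < fderiv ℝ T.ρ z (0, 1) := by
  have h1 := (h z.1 z.2 hz).1
  rw [T.deriv_τ_eq hz, div_neg_iff] at h1
  have := pow_pos (T.r_pos z hz) 2
  rcases h1 with h1 | h1 <;> linarith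

end Adiabatic

/-! ### An explicit ideal gas -/

/-- The parameter `a = √(1 + 4 p e^s)` of a state `(s, p)` of the explicit ideal gas. -/
def gasParam (z : ℝ × ℝ) : ℝ := √(1 + 4 * z.2 * Real.exp z.1)

/-- The matter density of the explicit ideal gas. -/
def gasDensity (z : ℝ × ℝ) : ℝ :=
  Real.exp (-z.1) * (gasParam z + 1) * Real.exp ((gasParam z - 1) / (2 * (gasParam z + 1)))

/-- The relativistic specific enthalpy `1 + i` of the explicit ideal gas. -/
def gasIndex (z : ℝ × ℝ) : ℝ :=
  (gasParam z + 1) / 2 * Real.exp (-((gasParam z - 1) / (2 * (gasParam z + 1))))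

/-- The states of the explicit ideal gas. -/
def gasStates : Set (ℝ × ℝ) := {z | 0 < 1 + 4 * z.2 * Real.exp z.1}

theorem gasParam_add_one_pos (z : ℝ × ℝ) : 0 < gasParam z + 1 := by
  have := Real.sqrt_nonneg (1 + 4 * z.2 * Real.exp z.1)
  unfold gasParam
  linarith

theorem gasParam_pos {z : ℝ × ℝ} (hz : z ∈ gasStates) : 0 < gasParam z := Real.sqrt_pos.2 hz

theorem gasParam_sq {z : ℝ × ℝ} (hz : z ∈ gasStates) :
    gasParam z ^ 2 = 1 + 4 * z.2 * Real.exp z.1 := Real.sq_sqrt (le_of_lt hz)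

theorem gasDensity_pos (z : ℝ × ℝ) : 0 < gasDensity z := by
  have := gasParam_add_one_pos z
  unfold gasDensity
  positivity

/-- The states include some with negative pressure, so that those with `p = 0`, where `gasParam` is
`1`, are interior points. -/
theorem isOpen_gasStates : IsOpen gasStates :=
  isOpen_lt continuous_const (by fun_prop)

theorem contDiffAt_gasParam {z : ℝ × ℝ} (hz : z ∈ gasStates) : ContDiffAt ℝ ∞ gasParam z := by
  have h : ContDiff ℝ ∞ fun z : ℝ × ℝ => 1 + 4 * z.2 * Real.exp z.1 := by fun_prop
  exact h.contDiffAt.sqrt (ne_of_gt hz)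

theorem contDiffAt_gasDensity {z : ℝ × ℝ} (hz : z ∈ gasStates) :
    ContDiffAt ℝ ∞ gasDensity z := by
  have h := contDiffAt_gasParam hz
  have h0 := (gasParam_add_one_pos z).ne'
  have h1 : ContDiffAt ℝ ∞ (fun z : ℝ × ℝ => Real.exp (-z.1)) z := by fun_prop
  exact (h1.mul (h.add contDiffAt_const)).mul
    (((h.sub contDiffAt_const).div (contDiffAt_const.mul (h.add contDiffAt_const))
      (by simpa using h0)).exp)

theorem contDiffAt_gasIndex {z : ℝ × ℝ} (hz : z ∈ gasStates) : ContDiffAt ℝ ∞ gasIndex z := by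
  have h := contDiffAt_gasParam hz
  have h0 := (gasParam_add_one_pos z).ne'
  exact ((h.add contDiffAt_const).div_const 2).mul
    (((h.sub contDiffAt_const).div (contDiffAt_const.mul (h.add contDiffAt_const))
      (by simpa using h0)).neg.exp)

theorem contDiffAt_snd_div_gasDensity {z : ℝ × ℝ} (hz : z ∈ gasStates) :
    ContDiffAt ℝ ∞ (fun z : ℝ × ℝ => z.2 / gasDensity z) z :=
  contDiffAt_snd.div (contDiffAt_gasDensity hz) (gasDensity_pos z).ne'

theorem hasFDerivAt_gasParam {z : ℝ × ℝ} (hz : z ∈ gasStates) :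
    HasFDerivAt gasParam ((2 * Real.exp z.1 / gasParam z) •
      (z.2 • ContinuousLinearMap.fst ℝ ℝ ℝ + ContinuousLinearMap.snd ℝ ℝ ℝ)) z := by
  have h1 : HasFDerivAt (fun z : ℝ × ℝ => 1 + 4 * z.2 * Real.exp z.1) _ z :=
    (((hasFDerivAt_snd (𝕜 := ℝ) (p := z)).const_mul 4).mul
      (hasFDerivAt_fst (𝕜 := ℝ) (p := z)).exp).const_add 1
  refine (h1.sqrt (ne_of_gt hz)).congr_fderiv ?_
  have := (gasParam_pos hz).ne'
  change (1 / (2 * gasParam z)) • _ = _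
  ext <;> simp <;> field_simp <;> ring

/-- The enthalpy balance `d(1 + i) = Θ ds + v dp` of the explicit ideal gas. -/
theorem hasFDerivAt_gasIndex {z : ℝ × ℝ} (hz : z ∈ gasStates) :
    HasFDerivAt gasIndex ((1 / gasDensity z) •
      (z.2 • ContinuousLinearMap.fst ℝ ℝ ℝ + ContinuousLinearMap.snd ℝ ℝ ℝ)) z := by
  have ha := (gasParam_pos hz).ne'
  have ha1 := (gasParam_add_one_pos z).ne'
  -- Enthalpy as a function of the parameter `a` alone; the chain rule through `gasParam` then gives
  -- the factor `1 / r`.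
  have hF : HasDerivAt (fun a : ℝ => (a + 1) / 2 * Real.exp (-((a - 1) / (2 * (a + 1)))))
      (gasParam z / (2 * (gasParam z + 1)) *
        Real.exp (-((gasParam z - 1) / (2 * (gasParam z + 1))))) (gasParam z) := by
    have i := hasDerivAt_id (gasParam z)
    have h : HasDerivAt (fun a : ℝ => (a + 1) / 2 * Real.exp (-((a - 1) / (2 * (a + 1))))) _
        (gasParam z) := ((i.add_const 1).div_const 2).mul
      (((i.sub_const 1).fun_div ((i.add_const 1).const_mul 2)
        (mul_ne_zero two_ne_zero ha1)).fun_neg.exp)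
    refine h.congr_deriv ?_
    simp only [id]
    field_simp
    ring
  refine (hF.comp_hasFDerivAt z (hasFDerivAt_gasParam hz)).congr_fderiv ?_
  rw [smul_smul]
  congr 1
  unfold gasDensity
  rw [Real.exp_neg, Real.exp_neg]
  field_simp

/-- An ideal gas, with `k = 1`, whose states with `0 ≤ p` realize all the values of the energy
density and the pressure with `0 ≤ p < ρ`. -/
def gas : Thermodynamics where
  D := gasStates
  r := gasDensity
  ε z := gasIndex z - 1 - z.2 / gasDensity z
  Θ z := z.2 / gasDensity z
  isOpen_D := isOpen_gasStates
  smooth_r _ hz := (contDiffAt_gasDensity hz).contDiffWithinAt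
  smooth_ε _ hz := (((contDiffAt_gasIndex hz).sub contDiffAt_const).sub
    (contDiffAt_snd_div_gasDensity hz)).contDiffWithinAt
  smooth_Θ _ hz := (contDiffAt_snd_div_gasDensity hz).contDiffWithinAt
  r_pos z _ := gasDensity_pos z
  balance z hz := by
    have hr0 := (gasDensity_pos z).ne'
    have hr := ((contDiffAt_gasDensity hz).differentiableAt (by simp)).hasFDerivAt
    have hv : HasFDerivAt (fun z' => 1 / gasDensity z') _ z :=
      hasFDerivAt_one_div hr hr0
    have hε : HasFDerivAt (fun z => gasIndex z - 1 - z.2 * (1 / gasDensity z)) _ z :=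
      ((hasFDerivAt_gasIndex hz).sub_const 1).sub
        ((hasFDerivAt_snd (𝕜 := ℝ) (p := z)).mul hv)
    have e : (fun z : ℝ × ℝ => gasIndex z - 1 - z.2 / gasDensity z) =
        fun z => gasIndex z - 1 - z.2 * (1 / gasDensity z) :=
      funext fun z => by rw [div_eq_mul_one_div z.2]
    rw [e, hε.fderiv, hv.fderiv]
    ext <;> simp; field_simp

theorem gas_isIdealGas : gas.IsIdealGas := by
  refine ⟨1, one_pos, fun z _ => ?_⟩
  have := (gasDensity_pos z).ne'
  change z.2 = 1 * gasDensity z * (z.2 / gasDensity z)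
  field_simp

/-- The factors `a + 1` of enthalpy and density cancel and their exponentials combine, so `log τ` is
elementary in `s` and `a`. -/
theorem gas_τ (z : ℝ × ℝ) :
    gas.τ z = Real.exp (z.1 - (gasParam z - 1) / (gasParam z + 1)) / 2 := by
  have h1 := (gasParam_add_one_pos z).ne'
  change (1 + ((gasIndex z - 1 - z.2 / gasDensity z) + z.2 * (1 / gasDensity z)))
    * (1 / gasDensity z) = _
  have : 1 + ((gasIndex z - 1 - z.2 / gasDensity z) + z.2 * (1 / gasDensity z)) = gasIndex z := by
    ring
  rw [this]
  unfold gasIndex gasDensity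
  have e : z.1 - (gasParam z - 1) / (gasParam z + 1) = z.1 -
    ((gasParam z - 1) / (2 * (gasParam z + 1)) + (gasParam z - 1) / (2 * (gasParam z + 1))) := by
    field_simp; ring
  rw [e, Real.exp_sub, Real.exp_add, Real.exp_neg, Real.exp_neg]
  field_simp

theorem hasDerivAt_gasParam_snd {s p : ℝ} (h : (s, p) ∈ gasStates) :
    HasDerivAt (fun p' => gasParam (s, p')) (2 * Real.exp s / gasParam (s, p)) p := by
  have hp : HasDerivAt (fun p : ℝ => (s, p)) (0, 1) p :=
    (hasDerivAt_const p s).prodMk (hasDerivAt_id p)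
  refine (HasFDerivAt.comp_hasDerivAt (f := fun p : ℝ => (s, p)) p
    (hasFDerivAt_gasParam h) hp).congr_deriv ?_
  simp

theorem hasDerivAt_gasParam_fst {s p : ℝ} (h : (s, p) ∈ gasStates) :
    HasDerivAt (fun s' => gasParam (s', p)) (2 * p * Real.exp s / gasParam (s, p)) s := by
  have hp : HasDerivAt (fun s : ℝ => (s, p)) (1, 0) s :=
    (hasDerivAt_id s).prodMk (hasDerivAt_const s p)
  refine (HasFDerivAt.comp_hasDerivAt (f := fun s : ℝ => (s, p)) s
    (hasFDerivAt_gasParam h) hp).congr_deriv ?_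
  simp
  ring

theorem hasDerivAt_gas_τ_snd {s p : ℝ} (h : (s, p) ∈ gasStates) :
    HasDerivAt (fun p' => gas.τ (s, p')) (-(2 * Real.exp s) * (gas.τ (s, p) *
      (1 / (gasParam (s, p) * (gasParam (s, p) + 1) ^ 2)) * 2)) p := by
  have ha := (gasParam_pos h).ne'
  have ha1 := (gasParam_add_one_pos (s, p)).ne'
  have d := hasDerivAt_gasParam_snd h
  have h1 := ((((d.sub_const 1).fun_div (d.add_const 1) ha1).const_sub s).exp).div_const 2
  simp only [gas_τ]
  refine h1.congr_deriv ?_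
  field_simp
  ring

/-- One has `τ'_p = -4 e^s τ / (a (a+1)²)`. As `p` grows `a` increases and `τ` decreases, so `-τ'_p`
is a product of positive factors none of which increases. -/
theorem gas_H₁ : gas.H₁ := by
  intro s p h
  have h : (s, p) ∈ gasStates := h
  have ha := gasParam_pos h
  have hτ : 0 < gas.τ (s, p) := by rw [gas_τ]; positivity
  have hd := hasDerivAt_gas_τ_snd h
  refine ⟨?_, ?_⟩
  · rw [hd.deriv]
    have : 0 < 2 * Real.exp s * (gas.τ (s, p) *
      (1 / (gasParam (s, p) * (gasParam (s, p) + 1) ^ 2)) * 2) := by positivity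
    linarith
  · have e : deriv (fun p' => gas.τ (s, p')) =ᶠ[𝓝 p] fun p' => -(2 * Real.exp s) * (gas.τ (s, p') *
      (1 / (gasParam (s, p') * (gasParam (s, p') + 1) ^ 2)) * 2) := by
      have ho : IsOpen {p' : ℝ | (s, p') ∈ gasStates} :=
        isOpen_gasStates.preimage (by fun_prop)
      filter_upwards [ho.mem_nhds h] with p' hp' using (hasDerivAt_gas_τ_snd hp').deriv
    have d := hasDerivAt_gasParam_snd h
    have d2 := ((hd.mul ((hasDerivAt_const p (1 : ℝ)).fun_div (d.mul ((d.add_const 1).fun_pow 2))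
      (mul_pos ha (pow_pos (gasParam_add_one_pos (s, p)) 2)).ne')).mul_const 2).const_mul (-(2 * Real.exp s))
    have d3 : deriv (deriv (fun p' => gas.τ (s, p'))) p = _ := e.deriv_eq.trans d2.deriv
    rw [iteratedDeriv_succ, iteratedDeriv_one, d3]
    set a := gasParam (s, p)
    set t := gas.τ (s, p)
    set E := Real.exp s with hE
    have hEp : 0 < E := Real.exp_pos s
    simp only [Pi.mul_apply]
    -- The signs are absorbed so that every term is visibly positive.
    have : -(2 * E) * ((-(2 * E) * (t * (1 / (a * (a + 1) ^ 2)) * 2) * (1 / (a * (a + 1) ^ 2))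
      + t * ((0 * (a * (a + 1) ^ 2) - 1 * (2 * E / a * (a + 1) ^ 2 +
        a * ((2 : ℕ) * (a + 1) ^ (2 - 1) * (2 * E / a)))) / (a * (a + 1) ^ 2) ^ 2)) * 2) =
      2 * E * (2 * E * (t * (1 / (a * (a + 1) ^ 2)) * 2) * (1 / (a * (a + 1) ^ 2))
      + t * ((2 * E / a * (a + 1) ^ 2 + a * (2 * (a + 1) * (2 * E / a))) /
        (a * (a + 1) ^ 2) ^ 2)) * 2 := by
      norm_num
      ring
    rw [this]
    positivity

/-- By `2 p e^s = (a² - 1)/2`, the logarithmic derivative `(log τ)'_s` equals `(a² + 1)/(a (a+1))`.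
-/
theorem gas_H₂ : gas.H₂ := by
  intro s p h
  have h : (s, p) ∈ gasStates := h
  have ha := gasParam_pos h
  have ha1 := (gasParam_add_one_pos (s, p)).ne'
  have hsq := gasParam_sq h
  have d := hasDerivAt_gasParam_fst h
  have h1 :=
    ((((hasDerivAt_id s).sub ((d.sub_const 1).fun_div (d.add_const 1) ha1))).exp).div_const 2
  simp only [gas_τ]
  have h2 := h1.deriv
  simp only [Pi.sub_apply, id] at h2
  rw [h2]
  simp only at hsq
  set a := gasParam (s, p)
  have : 1 - ((2 * p * Real.exp s / a) * (a + 1) - (a - 1) * (2 * p * Real.exp s / a)) /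
      (a + 1) ^ 2 = (a ^ 2 + 1) / (a * (a + 1)) := by
    have : 2 * p * Real.exp s = (a ^ 2 - 1) / 2 := by linarith
    rw [this]
    field_simp
    ring
  rw [this]
  positivity

/-- The specific entropy of the explicit ideal gas as a function of the energy density and the
pressure. -/
def gasEntropy (ρ p : ℝ) : ℝ := Real.log (2 * (ρ + p) / (ρ - p) ^ 2)

theorem exp_gasEntropy {ρ p : ℝ} (h0 : 0 ≤ p) (h : p < ρ) :
    Real.exp (gasEntropy ρ p) = 2 * (ρ + p) / (ρ - p) ^ 2 := by
  have : 0 < ρ - p := sub_pos.2 h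
  have : 0 < ρ + p := by linarith
  exact Real.exp_log (by positivity)

theorem gasEntropy_mem {ρ p : ℝ} (h0 : 0 ≤ p) : (gasEntropy ρ p, p) ∈ gas.D := by
  change 0 < 1 + 4 * p * Real.exp (gasEntropy ρ p)
  positivity

/-- The equations `4 p e^s = a² - 1` and `ρ + p = ½ e^{-s}(a+1)²` have the solution `a =
(ρ+3p)/(ρ-p)`, `e^s = 2(ρ+p)/(ρ-p)²`; the condition `0 ≤ p < ρ` makes both positive. -/
theorem gas_ρ_gasEntropy {ρ p : ℝ} (h0 : 0 ≤ p) (h : p < ρ) :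
    gas.ρ (gasEntropy ρ p, p) = ρ := by
  have h1 : 0 < ρ - p := sub_pos.2 h
  have h2 : 0 < ρ + p := by linarith
  have ha : gasParam (gasEntropy ρ p, p) = (ρ + 3 * p) / (ρ - p) := by
    unfold gasParam
    rw [Real.sqrt_eq_iff_eq_sq (gasEntropy_mem (ρ := ρ) h0).le (div_nonneg (by linarith) h1.le),
      exp_gasEntropy h0 h]
    field_simp
    ring
  have hr := (gasDensity_pos (gasEntropy ρ p, p)).ne'
  set z : ℝ × ℝ := (gasEntropy ρ p, p) with hz
  change gasDensity z * (1 + (gasIndex z - 1 - p / gasDensity z)) = ρ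
  have e1 : gasDensity z * (1 + (gasIndex z - 1 - p / gasDensity z)) =
      gasDensity z * gasIndex z - p := by
    field_simp
    ring
  have e2 : gasDensity z * gasIndex z = Real.exp (-z.1) * (gasParam z + 1) ^ 2 / 2 := by
    unfold gasDensity gasIndex
    rw [Real.exp_neg ((gasParam z - 1) / (2 * (gasParam z + 1)))]
    field_simp
  rw [e1, e2, ha, Real.exp_neg, exp_gasEntropy h0 h]
  field_simp
  ring

end Thermodynamics

/-! ### Ricci invariants of a perfect fluid. -/

section

variable {M : Type*} [TopologicalSpace M] [ChartedSpace E4 M] [IsManifold (𝓡 4) ∞ M]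

theorem mvfderiv_comp_pair {F : ℝ × ℝ → ℝ} {a b : M → ℝ} {x : M}
    (ha : ContMDiff (𝓡 4) 𝓘(ℝ, ℝ) ∞ a) (hb : ContMDiff (𝓡 4) 𝓘(ℝ, ℝ) ∞ b)
    (hF : DifferentiableAt ℝ F (a x, b x)) (v : TangentSpace (𝓡 4) x) :
    mvfderiv (𝓡 4) (fun x' => F (a x', b x')) x v =
      fderiv ℝ F (a x, b x) (mvfderiv (𝓡 4) a x v, mvfderiv (𝓡 4) b x v) := by
  have h1 : HasMFDerivAt (𝓡 4) 𝓘(ℝ, ℝ × ℝ) (fun x' => (a x', b x')) x _ :=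
    have h1 := ((ha x).mdifferentiableAt (by simp)).hasMFDerivAt
    have h2 := ((hb x).mdifferentiableAt (by simp)).hasMFDerivAt
    ⟨h1.1.prodMk h2.1, h1.2.prodMk h2.2⟩
  have h2 := HasMFDerivAt.comp x (hF.hasFDerivAt.hasMFDerivAt) h1
  have h3 := h2.mfderiv
  exact congrArg (fun L : E4 →L[ℝ] ℝ => L v) h3

theorem mvfderiv_eq_fderiv_symm {f : M → ℝ} (hf : ContMDiff (𝓡 4) 𝓘(ℝ, ℝ) ∞ f) (x : M)
    (v : TangentSpace (𝓡 4) x) : mvfderiv (𝓡 4) f x v =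
      fderiv ℝ (fun y => f ((extChartAt (𝓡 4) x).symm y)) (extChartAt (𝓡 4) x x) v := by
  rw [((hf x).mdifferentiableAt (by simp)).mvfderiv, ModelWithCorners.range_eq_univ,
    fderivWithin_univ]
  rfl

namespace LorentzMetric

variable {g : LorentzMetric M}

theorem sqTensor_apply (x : M) (S : TangentSpace (𝓡 4) x →L[ℝ] TangentSpace (𝓡 4) x →L[ℝ] ℝ)
    (v : TangentSpace (𝓡 4) x) : g.sqTensor x S v = S (g.mixed x S v) := rfl

theorem mixed_eq_of_apply {x : M}
    {S : TangentSpace (𝓡 4) x →L[ℝ] TangentSpace (𝓡 4) x →L[ℝ] ℝ} {u : TangentSpace (𝓡 4) x}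
    {a b : ℝ} (h : ∀ v w, S v w = a * (g.val x u v * g.val x u w) + b * g.val x v w)
    (v : TangentSpace (𝓡 4) x) : g.mixed x S v = (a * g.val x u v) • u + b • v := by
  apply g.val_injective
  ext w
  rw [val_mixed, h]
  simp only [map_add, map_smul, add_apply, smul_apply, smul_eq_mul]
  ring

section Fluid

variable {X u : ∀ x : M, TangentSpace (𝓡 4) x} {ρ p : M → ℝ}
  (h : g.IsPerfectFluidSolution X u ρ p) (x : M)
include h

theorem IsPerfectFluidSolution.t_eq : g.t x = ρ x - 3 * p x := by
  obtain ⟨e, η, he⟩ := g.exists_isOrthonormalBasis x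
  have hR : ∀ v w, g.ricci x v w = (ρ x + p x) * (g.val x (u x) v * g.val x (u x) w)
      + (p x + 1 / 2 * g.t x) * g.val x v w := by
    intro v w
    linear_combination h.einstein x v w
  have := (he.trace_fluid (h.unit x) (L := (g.mixed x (g.ricci x)).toLinearMap)
    (mixed_eq_of_apply hR)).1
  change g.t x = _ at this
  linarith

theorem IsPerfectFluidSolution.N_apply (v w : TangentSpace (𝓡 4) x) :
    g.N x v w = (ρ x + p x) * (g.val x (u x) v * g.val x (u x) w)
      + (ρ x + p x) / 4 * g.val x v w := by
  have ht := h.t_eq x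
  simp only [N, sub_apply, smul_apply, smul_eq_mul]
  linear_combination h.einstein x v w + 1 / 4 * g.val x v w * ht

theorem IsPerfectFluidSolution.q_eq : g.q x = ρ x + p x := by
  obtain ⟨e, η, he⟩ := g.exists_isOrthonormalBasis x
  have := (he.trace_fluid (h.unit x) (L := (g.mixed x (g.N x)).toLinearMap)
    (mixed_eq_of_apply (h.N_apply x))).2
  -- With `a = ρ+p` and `b = a/4`, one third of the trace of the cube is the exact cube of `-a/2`.
  rw [q, this, show (-(ρ x + p x) ^ 3 + 3 * (ρ x + p x) ^ 2 * ((ρ x + p x) / 4)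
    - 3 * (ρ x + p x) * ((ρ x + p x) / 4) ^ 2 + 4 * ((ρ x + p x) / 4) ^ 3) / 3 =
    (-(ρ x + p x) / 2) ^ 3 by ring, cbrt_cube]
  ring

theorem IsPerfectFluidSolution.Q_apply (v w : TangentSpace (𝓡 4) x) :
    g.Q x v w = (ρ x + p x) * (g.val x (u x) v * g.val x (u x) w) := by
  simp only [Q, sub_apply, smul_apply, smul_eq_mul, h.q_eq x, h.N_apply x]
  ring

theorem IsPerfectFluidSolution.rho_eq : g.rho x = ρ x := by
  rw [rho, h.q_eq, h.t_eq]
  ring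

theorem IsPerfectFluidSolution.pres_eq : g.pres x = p x := by
  rw [pres, h.q_eq, h.t_eq]
  ring

theorem IsPerfectFluidSolution.Q_sharp {ℓ : TangentSpace (𝓡 4) x →L[ℝ] ℝ} (hℓ : ℓ (u x) = 0) :
    g.Q x (g.sharp x ℓ) = 0 := by
  ext w
  rw [h.Q_apply, g.symm, val_sharp, hℓ]
  simp

end Fluid

/-- A unit time-like vector is not orthogonal to a time-like vector. -/
theorem val_ne_zero_of_timelike {x : M} {u v : TangentSpace (𝓡 4) x} (hu : g.val x u u = -1)
    (hv : g.val x v v < 0) : g.val x u v ≠ 0 := by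
  obtain ⟨b, hb⟩ := g.signature x
  have key : ∀ v w, g.val x v w = -(b.repr v 0 * b.repr w 0) + b.repr v 1 * b.repr w 1
      + b.repr v 2 * b.repr w 2 + b.repr v 3 * b.repr w 3 := by
    intro v w
    conv_lhs => rw [← b.sum_repr v, ← b.sum_repr w]
    simp only [Fin.sum_univ_four, map_add, map_smul, add_apply, smul_apply, smul_eq_mul, hb]
    simp
    ring
  intro h0
  rw [key] at hu hv h0
  generalize b.repr u 0 = a0 at *
  generalize b.repr u 1 = a1 at *
  generalize b.repr u 2 = a2 at *
  generalize b.repr u 3 = a3 at *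
  generalize b.repr v 0 = c0 at *
  generalize b.repr v 1 = c1 at *
  generalize b.repr v 2 = c2 at *
  generalize b.repr v 3 = c3 at *
  -- Cauchy–Schwarz for the spatial parts. Orthogonality would give `a0² c0² ≤ (a0² - 1) c0²`, hence
  -- `c0 = 0`, impossible for a time-like `v`.
  have cs : (a1 * c1 + a2 * c2 + a3 * c3) ^ 2 ≤
      (a1 ^ 2 + a2 ^ 2 + a3 ^ 2) * (c1 ^ 2 + c2 ^ 2 + c3 ^ 2) := by
    linarith [sq_nonneg (a1 * c2 - a2 * c1), sq_nonneg (a1 * c3 - a3 * c1),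
      sq_nonneg (a2 * c3 - a3 * c2)]
  have e1 : a1 * c1 + a2 * c2 + a3 * c3 = a0 * c0 := by linarith
  have e2 : a1 ^ 2 + a2 ^ 2 + a3 ^ 2 = a0 ^ 2 - 1 := by linarith
  have e3 : c1 ^ 2 + c2 ^ 2 + c3 ^ 2 < c0 ^ 2 := by linarith
  have e4 : 0 ≤ a0 ^ 2 - 1 := by rw [← e2]; positivity
  have e5 : 0 ≤ c1 ^ 2 + c2 ^ 2 + c3 ^ 2 := by positivity
  rw [e1, e2] at cs
  have e6 := mul_le_mul_of_nonneg_left e3.le e4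
  have e7 : (a0 * c0) ^ 2 = a0 ^ 2 * c0 ^ 2 := by ring
  linarith

/-! ### Reconstruction of the fluid from the Ricci tensor -/

section Reconstruction

theorem ricci_symm (x : M) (v w : TangentSpace (𝓡 4) x) : g.ricci x v w = g.ricci x w v := by
  obtain ⟨e, η, he⟩ := g.exists_isOrthonormalBasis_inChart x
  exact (g.isMetricOn_inChart x).ricciCoord_symm (mem_extChartAt_target x) he v w

theorem Q_symm (x : M) (v w : TangentSpace (𝓡 4) x) : g.Q x v w = g.Q x w v := by
  simp only [Q, N, sub_apply, smul_apply, ricci_symm x v w, g.symm x v w]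

/-- `N` is trace-free and the metric has trace `4`. -/
theorem trace_mixed_Q (x : M) :
    LinearMap.trace ℝ (TangentSpace (𝓡 4) x) (g.mixed x (g.Q x)).toLinearMap = -g.q x := by
  obtain ⟨e, η, he⟩ := g.exists_isOrthonormalBasis x
  have ht : g.t x = ∑ i, η i * g.ricci x (e i) (e i) := by
    rw [t, he.trace_eq]
    exact Finset.sum_congr rfl fun i _ => by
      rw [ContinuousLinearMap.coe_coe, val_mixed]
  rw [he.trace_eq]
  have : ∀ i, η i * g.val x ((g.mixed x (g.Q x)).toLinearMap (e i)) (e i) =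
      η i * g.ricci x (e i) (e i) - (1 / 4 * g.t x + 1 / 4 * g.q x) := by
    intro i
    have h1 : g.val x (e i) (e i) = η i := by simp [he.apply]
    rw [ContinuousLinearMap.coe_coe, val_mixed]
    simp only [Q, N, sub_apply, smul_apply, smul_eq_mul, h1]
    linear_combination (-(1 / 4 * g.t x + 1 / 4 * g.q x)) * he.sq i
  simp only [this]
  rw [Finset.sum_sub_distrib, ← ht, Finset.sum_const, Finset.card_fin, nsmul_eq_mul]
  push_cast
  ring

theorem contMDiff_t : ContMDiff (𝓡 4) 𝓘(ℝ, ℝ) ∞ g.t := by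
  have := g.contMDiff_trace_mixed_pow g.smoothTensor_ricci 1
  simp only [pow_one] at this
  exact this

theorem smoothTensor_N : SmoothTensor g.N :=
  g.smoothTensor_ricci.sub (g.smoothTensor_val.smul (contMDiff_const.mul contMDiff_t))

variable (h : g.RicciAlgebraic)
include h

theorem RicciAlgebraic.q_pos (x : M) : 0 < g.q x := by
  have := (h x).2.2
  linarith

theorem RicciAlgebraic.contMDiff_q : ContMDiff (𝓡 4) 𝓘(ℝ, ℝ) ∞ g.q := by
  have h3 := g.contMDiff_trace_mixed_pow (smoothTensor_N (g := g)) 3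
  intro x
  have hneg : LinearMap.trace ℝ (TangentSpace (𝓡 4) x)
      ((g.mixed x (g.N x)).toLinearMap ^ 3) / 3 < 0 := by
    have hq := h.q_pos x
    by_contra! hc
    rw [q, cbrt, if_pos hc] at hq
    have := Real.rpow_nonneg hc (1 / 3)
    linarith
  have hc : ContMDiffAt (𝓡 4) 𝓘(ℝ, ℝ) ∞ (fun x => LinearMap.trace ℝ (TangentSpace (𝓡 4) x)
      ((g.mixed x (g.N x)).toLinearMap ^ 3) / 3) x := (h3 x).div_const 3
  exact contMDiffAt_const.mul ((contDiffAt_cbrt hneg).contMDiffAt.comp x hc)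

theorem RicciAlgebraic.smoothTensor_Q : SmoothTensor g.Q :=
  smoothTensor_N.sub (g.smoothTensor_val.smul (contMDiff_const.mul h.contMDiff_q))

theorem RicciAlgebraic.rank_one (x : M) (X v w : TangentSpace (𝓡 4) x) :
    g.Q x X X * g.Q x v w = g.Q x X v * g.Q x X w := by
  obtain ⟨e, η, he⟩ := g.exists_isOrthonormalBasis x
  refine he.rank_one (Q_symm x) (h.q_pos x).ne' (L := (g.mixed x (g.Q x)).toLinearMap)
    (g.val_mixed x (g.Q x)) (fun v => ?_) (trace_mixed_Q x) X v w
  exact congrArg (fun S : TangentSpace (𝓡 4) x →L[ℝ] TangentSpace (𝓡 4) x →L[ℝ] ℝ => S v) (h x).1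

omit h in
/-- The unit velocity determined by the Ricci tensor and a time-like vector field `X`. -/
def velocity (g : LorentzMetric M) (X : ∀ x : M, TangentSpace (𝓡 4) x) (x : M) :
    TangentSpace (𝓡 4) x :=
  -- If `Q = q u⊗u`, then `X` is sent to `q g(u, X) u`, and the root is `q |g(u, X)|`; the minus
  -- sign selects the `u` with `g(u, X) < 0`.
  (-(√(g.q x * g.Q x (X x) (X x)))⁻¹) • g.mixed x (g.Q x) (X x)

variable {X : ∀ x : M, TangentSpace (𝓡 4) x} (hX : g.IsTimeOrientation X)
include hX

theorem RicciAlgebraic.Q_pos (x : M) : 0 < g.q x * g.Q x (X x) (X x) :=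
  mul_pos (h.q_pos x) ((h x).2.1 _ (hX.2 x))

theorem RicciAlgebraic.smooth_velocity : SmoothVectorField (g.velocity X) := by
  have hs := h.contMDiff_q.mul (h.smoothTensor_Q.apply hX.1 hX.1)
  have h1 : ContMDiff (𝓡 4) 𝓘(ℝ, ℝ) ∞ fun x => -(√(g.q x * g.Q x (X x) (X x)))⁻¹ := by
    intro x
    have hp := h.Q_pos hX x
    have hf : ContDiffAt ℝ ∞ (fun a : ℝ => -(√a)⁻¹) (g.q x * g.Q x (X x) (X x)) :=
      ((contDiffAt_id.sqrt hp.ne').inv (Real.sqrt_pos.2 hp).ne').neg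
    exact ContMDiffAt.comp (g := fun a : ℝ => -(√a)⁻¹) x hf.contMDiffAt (hs x)
  exact (g.smoothVectorField_mixed h.smoothTensor_Q hX.1).smul h1

theorem RicciAlgebraic.val_velocity (x : M) (v : TangentSpace (𝓡 4) x) :
    g.val x (g.velocity X x) v = -(√(g.q x * g.Q x (X x) (X x)))⁻¹ * g.Q x (X x) v := by
  rw [velocity, map_smul, val_mixed, smul_apply, smul_eq_mul]

/-- The rank-one identity at `X`, divided by `Q(X, X) > 0`. -/
theorem RicciAlgebraic.Q_eq (x : M) (v w : TangentSpace (𝓡 4) x) : g.Q x v w =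
    g.q x * (g.val x (g.velocity X x) v * g.val x (g.velocity X x) w) := by
  have hp := h.Q_pos hX x
  have hq := (h.q_pos x).ne'
  have hQ : g.Q x (X x) (X x) ≠ 0 := (pos_of_mul_pos_right hp (h.q_pos x).le).ne'
  have hs := Real.sq_sqrt hp.le
  have hs0 := (Real.sqrt_pos.2 hp).ne'
  rw [h.val_velocity hX, h.val_velocity hX]
  have hr := h.rank_one x (X x) v w
  have e : g.q x * (-(√(g.q x * g.Q x (X x) (X x)))⁻¹ * g.Q x (X x) v *
      (-(√(g.q x * g.Q x (X x) (X x)))⁻¹ * g.Q x (X x) w)) =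
      g.q x * (g.Q x (X x) v * g.Q x (X x) w) / √(g.q x * g.Q x (X x) (X x)) ^ 2 := by
    field_simp
  rw [e, hs, ← hr]
  field_simp

/-- The norm of the image of `X` is `Q²(X, X) = -q Q(X, X)`, which the normalizing root turns into
`-1`. -/
theorem RicciAlgebraic.unit_velocity (x : M) :
    g.val x (g.velocity X x) (g.velocity X x) = -1 := by
  have hp := h.Q_pos hX x
  have hs := Real.sq_sqrt hp.le
  have hs0 := (Real.sqrt_pos.2 hp).ne'
  have hsq := congrArg (fun S : TangentSpace (𝓡 4) x →L[ℝ] TangentSpace (𝓡 4) x →L[ℝ] ℝ =>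
    S (X x) (X x)) (h x).1
  simp only [add_apply, sqTensor_apply, smul_apply, smul_eq_mul, zero_apply] at hsq
  rw [h.val_velocity hX, velocity, map_smul, smul_eq_mul,
    Q_symm x (X x) (g.mixed x (g.Q x) (X x))]
  have e : g.Q x (g.mixed x (g.Q x) (X x)) (X x) = -√(g.q x * g.Q x (X x) (X x)) ^ 2 := by
    rw [hs]; linarith
  rw [e]
  field_simp

theorem RicciAlgebraic.ricci_eq (x : M) (v w : TangentSpace (𝓡 4) x) : g.ricci x v w =
    g.q x * (g.val x (g.velocity X x) v * g.val x (g.velocity X x) w)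
      + (1 / 4 * g.q x + 1 / 4 * g.t x) * g.val x v w := by
  rw [← h.Q_eq hX]
  simp only [Q, N, sub_apply, smul_apply, smul_eq_mul]
  ring

theorem RicciAlgebraic.contMDiff_rho : ContMDiff (𝓡 4) 𝓘(ℝ, ℝ) ∞ g.rho :=
  contMDiff_const.mul ((contMDiff_const.mul h.contMDiff_q).add contMDiff_t)

theorem RicciAlgebraic.contMDiff_pres : ContMDiff (𝓡 4) 𝓘(ℝ, ℝ) ∞ g.pres :=
  contMDiff_const.mul (h.contMDiff_q.sub contMDiff_t)

theorem RicciAlgebraic.isPerfectFluidSolution :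
    g.IsPerfectFluidSolution X (g.velocity X) g.rho g.pres where
  smooth_u := h.smooth_velocity hX
  smooth_ρ := h.contMDiff_rho hX
  smooth_p := h.contMDiff_pres hX
  unit := h.unit_velocity hX
  future x := by
    rw [h.val_velocity hX, neg_mul, neg_lt_zero]
    exact mul_pos (inv_pos.2 (Real.sqrt_pos.2 (h.Q_pos hX x))) ((h x).2.1 _ (hX.2 x))
  einstein x v w := by
    rw [h.ricci_eq hX, rho, pres]
    ring

theorem RicciAlgebraic.mvfderiv_velocity {f : M → ℝ} (hf : g.QAnnihilates f) (x : M) :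
    mvfderiv (𝓡 4) f x (g.velocity X x) = 0 := by
  have h1 := congrArg (fun ℓ : TangentSpace (𝓡 4) x →L[ℝ] ℝ => ℓ (g.velocity X x)) (hf x)
  simp only [h.Q_eq hX, zero_apply, h.unit_velocity hX] at h1
  rw [g.symm, val_sharp] at h1
  have := (h.q_pos x).ne'
  simpa [this] using h1

/-- Ricci is `q u⊗u + l g` with `q = ρ + p` and `l = ½(ρ - p)`, both constant along the flow, and
conservation of energy applies in the chart around `x`. -/
theorem RicciAlgebraic.expansion_velocity (hρ : g.QAnnihilates g.rho)
    (hp : g.QAnnihilates g.pres) (x : M) : g.expansion (g.velocity X) x = 0 := by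
  obtain ⟨e, η, he⟩ := g.exists_isOrthonormalBasis_inChart x
  have hu := h.smooth_velocity hX
  have hq : ContMDiff (𝓡 4) 𝓘(ℝ, ℝ) ∞ g.q := h.contMDiff_q
  have hl : ContMDiff (𝓡 4) 𝓘(ℝ, ℝ) ∞ fun x => 1 / 4 * g.q x + 1 / 4 * g.t x :=
    (contMDiff_const.mul hq).add (contMDiff_const.mul contMDiff_t)
  have hsm : ∀ {f : M → ℝ}, ContMDiff (𝓡 4) 𝓘(ℝ, ℝ) ∞ f →
      MDifferentiableAt (𝓡 4) 𝓘(ℝ, ℝ) f x := fun hf => (hf x).mdifferentiableAt (by simp)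
  have dρ := h.mvfderiv_velocity hX hρ x
  have dp := h.mvfderiv_velocity hX hp x
  have hrs := hsm (h.contMDiff_rho hX)
  have hps := hsm (h.contMDiff_pres hX)
  have dq : mvfderiv (𝓡 4) g.q x (g.velocity X x) = 0 := by
    have e : g.q = fun x => g.rho x + g.pres x := funext fun x => by rw [rho, pres]; ring
    rw [e, mvfderiv_fun_add hrs hps, add_apply, dρ, dp, add_zero]
  have dl : mvfderiv (𝓡 4) (fun x => 1 / 4 * g.q x + 1 / 4 * g.t x) x (g.velocity X x) = 0 := by
    have e : (fun x => 1 / 4 * g.q x + 1 / 4 * g.t x) = fun x => 1 / 2 * (g.rho x - g.pres x) :=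
      funext fun x => by rw [rho, pres]; ring
    rw [e, mvfderiv_fun_mul (hsm contMDiff_const)
      (hsm ((h.contMDiff_rho hX).sub (h.contMDiff_pres hX))),
      mvfderiv_fun_sub hrs hps, mvfderiv_const]
    simp [dρ, dp]
  have hU0 : components x (g.velocity X) (extChartAt (𝓡 4) x x) = g.velocity X x := by
    rw [components_extChartAt x _ (mem_extChartAt_source x), chartD_self]
    rfl
  rw [mvfderiv_eq_fderiv_symm hq] at dq
  rw [mvfderiv_eq_fderiv_symm hl] at dl
  have ht := extChartAt_target_mem_nhds (I := 𝓡 4) x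
  have hval : ∀ y ∈ (extChartAt (𝓡 4) x).target, ∀ v : E4,
      g.inChart x y (components x (g.velocity X) y) v =
        g.val _ (g.velocity X ((extChartAt (𝓡 4) x).symm y)) (chartSymmD x y v) := by
    intro y hy v
    rw [inChart_eq, components, chartSymmD_chartD x hy]
  refine (g.isMetricOn_inChart x).trace_covDerivCoord_eq_zero (mem_extChartAt_target x) he
    (U := components x (g.velocity X))
    (q := fun y => g.q ((extChartAt (𝓡 4) x).symm y))
    (l := fun y => 1 / 4 * g.q ((extChartAt (𝓡 4) x).symm y)
      + 1 / 4 * g.t ((extChartAt (𝓡 4) x).symm y))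
    ((contDiffAt_components x hu).differentiableAt (by simp))
    ((contDiffAt_symm_of_contMDiff hq x).differentiableAt (by simp))
    ((contDiffAt_symm_of_contMDiff hl x).differentiableAt (by simp))
    ?_ ?_ (by rw [hU0]; exact dq) (by rw [hU0]; exact dl) ?_
  · filter_upwards [ht] with y hy
    rw [hval y hy, components, chartSymmD_chartD x hy, h.unit_velocity hX]
  · filter_upwards [ht] with y hy v w
    rw [hval y hy, hval y hy, inChart_eq, ← h.ricci_eq hX,
      g.ricci_eq_ricciCoord x ((extChartAt (𝓡 4) x).map_target hy),
      (extChartAt (𝓡 4) x).right_inv hy, chartD_chartSymmD x hy, chartD_chartSymmD x hy]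
  · rw [extChartAt_to_inv]
    exact (h.q_pos x).ne'

end Reconstruction

end LorentzMetric

/-! ### The two implications. -/

open LorentzMetric Thermodynamics

theorem IsIsoenergeticIdealGasSolution.ricci_conditions {g : LorentzMetric M}
    {X : ∀ x : M, TangentSpace (𝓡 4) x} (h : IsIsoenergeticIdealGasSolution g X) :
    g.RicciAlgebraic ∧ g.QAnnihilates g.rho ∧ g.QAnnihilates g.pres := by
  obtain ⟨u, ρ, p, hf, hpρ, hiso, T, -, hH1, -, s, hs, hev⟩ := h
  have eρ : g.rho = ρ := funext hf.rho_eq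
  have ep : g.pres = p := funext hf.pres_eq
  -- Along `u` the relation `ρ = ρ(s, p)` differentiates to `0 = ρ'_p u(p)`, and `ρ'_p > 1`.
  have hpu : ∀ x, mvfderiv (𝓡 4) p x (u x) = 0 := by
    intro x
    obtain ⟨hD, -, hsu, -⟩ := hev x
    have h1 := mvfderiv_comp_pair hs hf.smooth_p (T.hasFDerivAt_ρ hD).differentiableAt (u x)
    rw [← show ρ = fun x' => T.ρ (s x', p x') from funext fun x => (hev x).2.1, hiso, hsu] at h1
    have h2 : ((0 : ℝ), mvfderiv (𝓡 4) p x (u x)) =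
        mvfderiv (𝓡 4) p x (u x) • ((0 : ℝ), (1 : ℝ)) := by
      simp
    rw [h2, map_smul, smul_eq_mul] at h1
    have h3 := T.one_lt_fderiv_ρ hD hH1
    exact (mul_eq_zero.1 h1.symm).resolve_right (by linarith)
  refine ⟨fun x => ⟨?_, fun v hv => ?_, ?_, ?_⟩, fun x => ?_, fun x => ?_⟩
  · ext v w
    have hQ : ∀ v w, g.Q x v w = (ρ x + p x) * (g.val x (u x) v * g.val x (u x) w)
        + 0 * g.val x v w := fun v w => by rw [hf.Q_apply]; ring
    simp only [add_apply, smul_apply, sqTensor_apply, mixed_eq_of_apply hQ, hf.q_eq x]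
    simp only [zero_smul, add_zero, map_smul, smul_apply, smul_eq_mul, hf.Q_apply, hf.unit,
      zero_apply]
    ring
  · rw [hf.Q_apply]
    have := hpρ x
    exact mul_pos (by linarith) (mul_self_pos.2 (val_ne_zero_of_timelike (hf.unit x) hv))
  · rw [hf.q_eq, hf.t_eq]
    linarith [hpρ x]
  · rw [hf.q_eq, hf.t_eq]
    linarith [hpρ x]
  · rw [eρ]
    exact hf.Q_sharp x (hiso x)
  · rw [ep]
    exact hf.Q_sharp x (hpu x)

theorem LorentzMetric.RicciAlgebraic.isIsoenergeticIdealGasSolution {g : LorentzMetric M}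
    {X : ∀ x : M, TangentSpace (𝓡 4) x} (hX : g.IsTimeOrientation X) (h : g.RicciAlgebraic)
    (hρ : g.QAnnihilates g.rho) (hp : g.QAnnihilates g.pres) :
    IsIsoenergeticIdealGasSolution g X := by
  have dρ := h.mvfderiv_velocity hX hρ
  have dp := h.mvfderiv_velocity hX hp
  have hpρ : ∀ x, 0 ≤ g.pres x ∧ g.pres x < g.rho x := by
    intro x
    have := (h x).2.2
    rw [pres, rho]
    constructor <;> linarith
  have sρ := h.contMDiff_rho hX
  have sp := h.contMDiff_pres hX
  have hsm : ∀ x, ContDiffAt ℝ ∞ (fun z : ℝ × ℝ => gasEntropy z.1 z.2) (g.rho x, g.pres x) := by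
    intro x
    have h1 : 0 < g.rho x - g.pres x := sub_pos.2 (hpρ x).2
    have h2 : 0 < g.rho x + g.pres x := by linarith [(hpρ x).1]
    unfold gasEntropy
    refine ContDiffAt.log (ContDiffAt.div (by fun_prop) (by fun_prop) ?_) ?_
    · exact (pow_pos h1 2).ne'
    · exact (div_pos (mul_pos two_pos h2) (pow_pos h1 2)).ne'
  have ss : ContMDiff (𝓡 4) 𝓘(ℝ, ℝ) ∞ fun x => gasEntropy (g.rho x) (g.pres x) := by
    intro x
    exact ContMDiffAt.comp (g := fun z : ℝ × ℝ => gasEntropy z.1 z.2) x (hsm x).contMDiffAt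
      ((sρ x).prodMk_space (sp x))
  have ds : ∀ x, mvfderiv (𝓡 4) (fun x => gasEntropy (g.rho x) (g.pres x)) x
      (g.velocity X x) = 0 := by
    intro x
    rw [mvfderiv_comp_pair (F := fun z : ℝ × ℝ => gasEntropy z.1 z.2) sρ sp
      ((hsm x).differentiableAt (by simp)), dρ, dp]
    exact map_zero _
  refine ⟨g.velocity X, g.rho, g.pres, h.isPerfectFluidSolution hX, hpρ, dρ, gas, gas_isIdealGas,
    gas_H₁, gas_H₂, _, ss, fun x => ?_⟩
  have hD := gasEntropy_mem (ρ := g.rho x) (hpρ x).1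
  refine ⟨hD, (gas_ρ_gasEntropy (hpρ x).1 (hpρ x).2).symm, ds x, ?_⟩
  -- Matter conservation holds term by term: `r` depends on the conserved `s` and `p`, and the
  -- expansion is zero.
  rw [mvfderiv_comp_pair ss sp (gas.hasFDerivAt_r hD).differentiableAt, ds, dp,
    h.expansion_velocity hX hρ hp, mul_zero, add_zero]
  exact map_zero _

end

end IdealGas

end

theorem theorem10 {M : Type*} [TopologicalSpace M] [ChartedSpace IdealGas.E4 M]
    [IsManifold (𝓡 4) ∞ M] (g : IdealGas.LorentzMetric M)
    (X : ∀ x : M, TangentSpace (𝓡 4) x) (hX : g.IsTimeOrientation X) :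
    IdealGas.IsIsoenergeticIdealGasSolution g X ↔
      g.RicciAlgebraic ∧ g.QAnnihilates g.rho ∧ g.QAnnihilates g.pres :=
  ⟨fun h => h.ricci_conditions, fun ⟨h, hρ, hp⟩ => h.isIsoenergeticIdealGasSolution hX hρ hp⟩
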